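/- Let $n,p\in\mathbb N$, $A\in\mathbb R^{n\times n}$, $C\in\mathbb R^{p\times n}$, and write $(A,C)$ for the system $\dot x(t)=Ax(t)$, $w(t)=Cx(t)$, $t\ge 0$, with state $x(t)\in\mathbb R^n$ and observation $w(t)\in\mathbb R^p$. Two systems $(A_1,C_1)$, $(A_2,C_2)$ with states in $\mathbb R^n$ and observations in $\mathbb R^p$ are topologically equivalent if there is a homeomorphism $H$ of $\mathbb R^n$ such that, for every solution $x$ of $\dot x=A_1x$ on $[0,\infty)$, $y(t)=H(x(t))$ solves $\dot y=A_2y$ on $[0,\infty)$ and $C_2y(t)=C_1x(t)$ for all $t\ge0$, and such that $H^{-1}$ has the same property with the two systems interchanged. They are linearly equivalent if $H$ can be chosen to be a linear isomorphism. The Kalman rank of observability $k_{obs}(A,C)$ is the rank of the matrix with block rows $C,CA,\dots,CA^{n-1}$; $(A,C)$ is completely observable if $k_{obs}(A,C)=n$. The system $(A,C)$ is linearly equivalent to a system $$\left(\begin{bmatrix}A^0&0&0\\0&A^+&0\\0&0&A^-\end{bmatrix},\ \begin{bmatrix}C^0&C^+&C^-\end{bmatrix}\right)$$ in which all eigenvalues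 of $A^0$, $A^+$, $A^-$ have zero, positive and negative real part, respectively. For any such decomposition, let $n^0,n^+,n^-$ be the sizes of $A^0,A^+,A^-$ and let $k^0_{obs},k^+_{obs},k^-_{obs}$ be the Kalman ranks of observability of $(A^0,C^0)$, $(A^+,C^+)$, $(A^-,C^-)$. (Blocks of size $0$ are allowed.) Fix any linear equivalence canonical form for completely observable systems with $p$ outputs, i.e. for each dimension $k$ a set $\mathcal F_k$ of completely observable systems with state space $\mathbb R^k$ that contains exactly one representative of each linear equivalence class of such systems. If $k^0_{obs}=n^0$, then there is exactly one $(\widehat L,\widehat T)\in\mathcal F_k$, $k=k_{obs}(A,C)$, such that $(A,C)$ is topologically equivalent to $$\left(\begin{bmatrix}\widehat L&0\\0&\widehat E\end{bmatrix},\ \begin{bmatrix}\widehat T&0\end{bmatrix}\right),$$ where $\widehat E$ is the diagonal matrix with $n^+-k^+_{obs}$ diagonal entries equal to $1$ followed by $n^--k^-_{obs}$ diagonal entries equal to $-1$. -/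

import Mathlib

/-- The system `x' = A x`, `w = C x` (for `t ≥ 0`) without control, with state in `ℝ^ι` and
observation in `ℝ^p`; it is identified with the pair of matrices `(A, C)`. -/
@[ext]
structure ObservedSystem (ι : Type*) (p : ℕ) where
  /-- the state matrix -/
  A : Matrix ι ι ℝ
  /-- the observation matrix -/
  C : Matrix (Fin p) ι ℝ

namespace ObservedSystem

variable {ι κ : Type*} [Fintype ι] [Fintype κ] {p : ℕ}

/-- `x` solves `x'(t) = A x(t)` for `t ≥ 0` (with the one-sided derivative at `t = 0`). -/
def IsSolution (S : ObservedSystem ι p) (x : ℝ → ι → ℝ) : Prop :=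
  ∀ t, 0 ≤ t → HasDerivWithinAt x (S.A.mulVec (x t)) (Set.Ici 0) t

/-- The transformation `(y(t), z(t)) = (h (x(t)), w(t))` brings `S₁` to `S₂`: it maps each solution
of `S₁` to a solution of `S₂`, and the observation is unchanged. -/
def Brings (S₁ : ObservedSystem ι p) (S₂ : ObservedSystem κ p) (h : (ι → ℝ) → (κ → ℝ)) : Prop :=
  ∀ x : ℝ → ι → ℝ, S₁.IsSolution x →
    S₂.IsSolution (fun t => h (x t)) ∧
      ∀ t, 0 ≤ t → S₂.C.mulVec (h (x t)) = S₁.C.mulVec (x t)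

/-- Topological equivalence of two systems with state spaces of the same dimension. -/
def TopologicallyEquivalent (S₁ : ObservedSystem ι p) (S₂ : ObservedSystem κ p) : Prop :=
  Fintype.card ι = Fintype.card κ ∧
    ∃ H : (ι → ℝ) ≃ₜ (κ → ℝ), S₁.Brings S₂ H ∧ S₂.Brings S₁ H.symm

/-- Linear equivalence: the transformation of the state is a linear isomorphism. -/
def LinearlyEquivalent (S₁ : ObservedSystem ι p) (S₂ : ObservedSystem κ p) : Prop :=
  ∃ H : (ι → ℝ) ≃ₗ[ℝ] (κ → ℝ), S₁.Brings S₂ H ∧ S₂.Brings S₁ H.symm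

/-- The system `(diag(A₁, A₂), [C₁ C₂])`. -/
def blockSum (S₁ : ObservedSystem ι p) (S₂ : ObservedSystem κ p) : ObservedSystem (ι ⊕ κ) p where
  A := Matrix.fromBlocks S₁.A 0 0 S₂.A
  C := Matrix.fromCols S₁.C S₂.C

/-- The observability matrix with block rows `C, C A, …, C A^(n-1)`. -/
def obsMatrix {n : ℕ} (S : ObservedSystem (Fin n) p) : Matrix (Fin n × Fin p) (Fin n) ℝ :=
  Matrix.of fun i j => (S.C * S.A ^ (i.1 : ℕ)) i.2 j

/-- The Kalman rank of observability. -/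
noncomputable def kObs {n : ℕ} (S : ObservedSystem (Fin n) p) : ℕ :=
  S.obsMatrix.rank

/-- Complete observability: the Kalman rank equals the dimension of the state space. -/
def CompletelyObservable {n : ℕ} (S : ObservedSystem (Fin n) p) : Prop :=
  S.kObs = n

/-- All the (complex) eigenvalues of the state matrix have a real part satisfying `P`. -/
def EigenvalueRe {n : ℕ} (S : ObservedSystem (Fin n) p) (P : ℝ → Prop) : Prop :=
  ∀ μ ∈ spectrum ℂ (S.A.map (algebraMap ℝ ℂ)), P μ.re

/-- A decomposition of `S` according to the real parts of the eigenvalues: subsystems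
`(A⁰, C⁰)`, `(A⁺, C⁺)`, `(A⁻, C⁻)` such that `S` is linearly equivalent to
`(diag(A⁰, A⁺, A⁻), [C⁰ C⁺ C⁻])` and the eigenvalues of `A⁰`, `A⁺`, `A⁻` have zero, positive and
negative real parts. The indices of `S` are read off from it: `n⁰, n⁺, n⁻` are `nZero, nPlus, nMinus`
and the partial Kalman ranks `k⁰, k⁺, k⁻` are `zero.kObs, plus.kObs, minus.kObs`. -/
structure SpectralDecomposition {n : ℕ} (S : ObservedSystem (Fin n) p) where
  /-- the index `n⁰` -/
  nZero : ℕ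
  /-- the index `n⁺` -/
  nPlus : ℕ
  /-- the index `n⁻` -/
  nMinus : ℕ
  /-- the subsystem `(A⁰, C⁰)` -/
  zero : ObservedSystem (Fin nZero) p
  /-- the subsystem `(A⁺, C⁺)` -/
  plus : ObservedSystem (Fin nPlus) p
  /-- the subsystem `(A⁻, C⁻)` -/
  minus : ObservedSystem (Fin nMinus) p
  linearlyEquivalent : S.LinearlyEquivalent (zero.blockSum (plus.blockSum minus))
  re_zero : zero.EigenvalueRe (fun r => r = 0)
  re_plus : plus.EigenvalueRe (fun r => 0 < r)
  re_minus : minus.EigenvalueRe (fun r => r < 0)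

/-- A linear equivalence canonical form for completely observable systems with `p` outputs: for each
dimension `k` a set of completely observable systems that contains exactly one representative of
each linear equivalence class of completely observable systems of dimension `k`. -/
structure IsLinearCanonicalForm (F : ∀ k : ℕ, Set (ObservedSystem (Fin k) p)) : Prop where
  completelyObservable : ∀ k, ∀ S ∈ F k, S.CompletelyObservable
  existsUnique : ∀ (k : ℕ) (S : ObservedSystem (Fin k) p), S.CompletelyObservable →
    ∃! R : ObservedSystem (Fin k) p, R ∈ F k ∧ S.LinearlyEquivalent R

/-- The unobserved system `(Ê, 0)`, where `Ê` is the diagonal matrix with `a` entries `1` followed by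
`b` entries `-1`. -/
def signSystem (a b p : ℕ) : ObservedSystem (Fin a ⊕ Fin b) p where
  A := Matrix.fromBlocks 1 0 0 (-1)
  C := 0

end ObservedSystem

/-! Since solutions are orbits of the linear flow, equivalence means a homeomorphism H that
intertwines the flows and the outputs (`FlowConj`). Such an H preserves outputs as functions of
time, hence their jets at 0, so the range of `obsMap` is an invariant, although H need not be
differentiable. An observable system is determined by this range up to linear isomorphism, which
gives uniqueness.

For existence, split by the sign of the real parts. On the plus part V, the unobservable subspace N
is invariant, but in general it has no invariant linear complement. Backward exponential decay
supplies a nonlinear substitute: a linear section of π : V → V/N, restricted to a level set that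
each nonzero orbit meets exactly once, extends along orbits to a continuous equivariant section Φ
(`Expanding.exists_section`). Then x ↦ (π x, x − Φ(π x)) conjugates the flow to that of V/N times N,
and the flow on N is conjugate to that of the identity field (`Expanding.exists_homeomorph`). The
minus part follows by reversing time. The zero part is observable by hypothesis and is kept
unchanged. The three observable pieces have pairwise coprime annihilating polynomials, so their sum
is observable (`obsMap_coprod_injective`), and comparing ranges shows that its dimension is the
Kalman rank. -/

open Filter Topology

set_option linter.unusedSectionVars false

/-! ### Linear flows and uniqueness of solutions -/

section Flow

variable {V W Y : Type*} [NormedAddCommGroup V] [NormedSpace ℝ V] [CompleteSpace V]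
  [NormedAddCommGroup W] [NormedSpace ℝ W] [CompleteSpace W]

/-- The flow `exp (t A)` of the linear vector field `A`. -/
noncomputable def flow (A : V →L[ℝ] V) (t : ℝ) : V →L[ℝ] V := NormedSpace.exp (t • A)

@[simp] theorem flow_zero (A : V →L[ℝ] V) : flow A 0 = 1 := by
  simp [flow, NormedSpace.exp_zero]

theorem flow_add (A : V →L[ℝ] V) (s t : ℝ) : flow A (s + t) = flow A s * flow A t := by
  let _ : NormedAlgebra ℚ (V →L[ℝ] V) := NormedAlgebra.restrictScalars ℚ ℝ _
  rw [flow, add_smul, NormedSpace.exp_add_of_commute]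
  · rfl
  · exact ((Commute.refl A).smul_left s).smul_right t

theorem flow_add_apply (A : V →L[ℝ] V) (s t : ℝ) (x : V) :
    flow A (s + t) x = flow A s (flow A t x) := by
  rw [flow_add]; rfl

@[simp] theorem flow_neg_apply_flow (A : V →L[ℝ] V) (t : ℝ) (x : V) :
    flow A (-t) (flow A t x) = x := by
  rw [← flow_add_apply]; simp

@[simp] theorem flow_apply_flow_neg (A : V →L[ℝ] V) (t : ℝ) (x : V) :
    flow A t (flow A (-t) x) = x := by
  rw [← flow_add_apply]; simp

theorem flow_neg_field (A : V →L[ℝ] V) (t : ℝ) : flow (-A) t = flow A (-t) := by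
  simp [flow]

theorem flow_ne_zero (A : V →L[ℝ] V) (t : ℝ) {x : V} (hx : x ≠ 0) : flow A t x ≠ 0 := by
  intro h
  apply hx
  rw [← flow_neg_apply_flow A t x, h, map_zero]

theorem hasDerivAt_flow (A : V →L[ℝ] V) (t : ℝ) : HasDerivAt (flow A) (A * flow A t) t :=
  hasDerivAt_exp_smul_const' (𝕂 := ℝ) A t

theorem hasDerivAt_flow_apply (A : V →L[ℝ] V) (x : V) (t : ℝ) :
    HasDerivAt (fun s => flow A s x) (A (flow A t x)) t :=
  (hasDerivAt_flow A t).clm_apply (hasDerivAt_const t x) |>.congr_deriv (by simp)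

theorem continuous_flow (A : V →L[ℝ] V) : Continuous (flow A) :=
  continuous_iff_continuousAt.2 fun t => (hasDerivAt_flow A t).continuousAt

theorem continuous_flow_apply (A : V →L[ℝ] V) : Continuous fun q : ℝ × V => flow A q.1 q.2 :=
  ((continuous_flow A).comp continuous_fst).clm_apply continuous_snd

/-- Intertwining passes to powers, and the continuous map f may be applied termwise to the
exponential series. -/
theorem flow_intertwine {A : V →L[ℝ] V} {B : W →L[ℝ] W} (f : V →L[ℝ] W)
    (h : ∀ x, f (A x) = B (f x)) (t : ℝ) (x : V) : f (flow A t x) = flow B t (f x) := by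
  have hp : ∀ (n : ℕ) (x : V), f ((A ^ n) x) = (B ^ n) (f x) := by
    intro n
    induction n with
    | zero => simp
    | succ n ih =>
      intro x
      rw [pow_succ, pow_succ, mul_apply_eq_comp, mul_apply_eq_comp, ih, h]
  have h1 := (NormedSpace.exp_series_hasSum_exp' (𝕂 := ℝ) (t • A)).mapL
    (f ∘L (ContinuousLinearMap.apply ℝ V x))
  have h2 := (NormedSpace.exp_series_hasSum_exp' (𝕂 := ℝ) (t • B)).mapL
    (ContinuousLinearMap.apply ℝ W (f x))
  refine h1.unique ?_
  have : (fun b : ℕ => (ContinuousLinearMap.apply ℝ W (f x)) ((b.factorial : ℝ)⁻¹ • (t • B) ^ b)) =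
      fun b : ℕ => (f ∘L ContinuousLinearMap.apply ℝ V x) ((b.factorial : ℝ)⁻¹ • (t • A) ^ b) := by
    funext n
    simp only [smul_pow, map_smul, ContinuousLinearMap.apply_apply, ContinuousLinearMap.comp_apply,
      hp]
  rw [this] at h2
  exact h2

theorem flow_one_field (t : ℝ) (x : V) : flow (1 : V →L[ℝ] V) t x = Real.exp t • x := by
  have h : flow (1 : V →L[ℝ] V) t = algebraMap ℝ (V →L[ℝ] V) (Real.exp t) := by
    rw [Real.exp_eq_exp_ℝ, NormedSpace.algebraMap_exp_comm, flow, Algebra.algebraMap_eq_smul_one]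
  rw [h, Algebra.algebraMap_eq_smul_one]
  rfl

theorem flow_prodMap (A : V →L[ℝ] V) (B : W →L[ℝ] W) (t : ℝ) (q : V × W) :
    flow (A.prodMap B) t q = (flow A t q.1, flow B t q.2) :=
  Prod.ext
    (flow_intertwine (A := A.prodMap B) (B := A) (ContinuousLinearMap.fst ℝ V W)
      (fun _ => rfl) t q)
    (flow_intertwine (A := A.prodMap B) (B := B) (ContinuousLinearMap.snd ℝ V W)
      (fun _ => rfl) t q)

/-- Pulling x(s) back by the flow gives a curve with zero derivative. Right derivatives suffice for
constancy, so the endpoint 0 causes no trouble. -/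
theorem eq_flow_of_hasDerivWithinAt (A : V →L[ℝ] V) {x : ℝ → V}
    (hx : ∀ t, 0 ≤ t → HasDerivWithinAt x (A (x t)) (Set.Ici 0) t) {t : ℝ} (ht : 0 ≤ t) :
    x t = flow A t (x 0) := by
  have hd : ∀ s, 0 ≤ s →
      HasDerivWithinAt (fun s => flow A (-s) (x s)) 0 (Set.Ici 0) s := by
    intro s hs
    have h1 : HasDerivAt (fun s => flow A (-s)) (-(A * flow A (-s))) s := by
      have := (hasDerivAt_flow A (-s)).scomp s (hasDerivAt_neg s)
      rw [neg_smul, one_smul] at this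
      exact this
    refine (h1.hasDerivWithinAt.clm_apply (hx s hs)).congr_deriv ?_
    have := flow_intertwine (A := A) (B := A) A (fun _ => rfl) (-s) (x s)
    simp [this]
  have hc := constant_of_has_deriv_right_zero (f := fun s => flow A (-s) (x s)) (a := 0) (b := t)
    (fun s hs => ((hd s hs.1).continuousWithinAt).mono Set.Icc_subset_Ici_self)
    (fun s hs => (hd s hs.1).mono (Set.Ici_subset_Ici.2 hs.1)) t ⟨ht, le_rfl⟩
  have := congrArg (flow A t) hc
  simpa using this

end Flow

/-! ### Expanding fields -/

section Expanding

variable {V W : Type*} [NormedAddCommGroup V] [NormedSpace ℝ V] [CompleteSpace V]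
  [NormedAddCommGroup W] [NormedSpace ℝ W] [CompleteSpace W]

/-- The backward flow of `A` decays exponentially. -/
def Expanding (A : V →L[ℝ] V) : Prop :=
  ∃ K r : ℝ, 0 < r ∧ ∀ s, 0 ≤ s → ∀ x, ‖flow A (-s) x‖ ≤ K * Real.exp (-(r * s)) * ‖x‖

theorem Expanding.bound {A : V →L[ℝ] V} (hA : Expanding A) :
    ∃ K r : ℝ, 0 ≤ K ∧ 0 < r ∧ ∀ s, 0 ≤ s → ∀ x,
      ‖flow A (-s) x‖ ≤ K * Real.exp (-(r * s)) * ‖x‖ := by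
  obtain ⟨K, r, hr, h⟩ := hA
  refine ⟨|K|, r, abs_nonneg K, hr, fun s hs x => (h s hs x).trans ?_⟩
  gcongr
  exact le_abs_self K

theorem expanding_one : Expanding (1 : V →L[ℝ] V) :=
  ⟨1, 1, one_pos, fun s _ x => by
    rw [flow_one_field, norm_smul, Real.norm_eq_abs, Real.abs_exp]; simp⟩

/-- Passage to an invariant subspace; `Expanding.of_surjective` is the analogue for quotients. -/
theorem Expanding.of_injective {A : V →L[ℝ] V} {B : W →L[ℝ] W} (hB : Expanding B)
    (f : V →L[ℝ] W) (g : W →L[ℝ] V) (hgf : ∀ x, g (f x) = x) (h : ∀ x, f (A x) = B (f x)) :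
    Expanding A := by
  obtain ⟨K, r, hK, hr, hb⟩ := hB.bound
  refine ⟨‖g‖ * K * ‖f‖, r, hr, fun s hs x => ?_⟩
  rw [← hgf (flow A (-s) x), flow_intertwine f h]
  calc ‖g (flow B (-s) (f x))‖ ≤ ‖g‖ * ‖flow B (-s) (f x)‖ := g.le_opNorm _
    _ ≤ ‖g‖ * (K * Real.exp (-(r * s)) * (‖f‖ * ‖x‖)) := by
        gcongr
        refine (hb s hs _).trans ?_
        gcongr
        exact f.le_opNorm x
    _ = _ := by ring

theorem Expanding.of_surjective {A : V →L[ℝ] V} {B : W →L[ℝ] W} (hA : Expanding A)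
    (f : V →L[ℝ] W) (g : W →L[ℝ] V) (hfg : ∀ x, f (g x) = x) (h : ∀ x, f (A x) = B (f x)) :
    Expanding B := by
  obtain ⟨K, r, hK, hr, hb⟩ := hA.bound
  refine ⟨‖f‖ * K * ‖g‖, r, hr, fun s hs x => ?_⟩
  conv_lhs => rw [← hfg x]
  rw [← flow_intertwine f h]
  calc ‖f (flow A (-s) (g x))‖ ≤ ‖f‖ * ‖flow A (-s) (g x)‖ := f.le_opNorm _
    _ ≤ ‖f‖ * (K * Real.exp (-(r * s)) * (‖g‖ * ‖x‖)) := by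
        gcongr
        refine (hb s hs _).trans ?_
        gcongr
        exact g.le_opNorm x
    _ = _ := by ring

/-- If some backward time map of the flow is a strict contraction, then the backward flow decays
exponentially. -/
theorem expanding_of_contraction {A : V →L[ℝ] V} {T q : ℝ} (hT : 0 < T) (hq0 : 0 < q) (hq : q < 1)
    (h : ∀ x, ‖flow A (-T) x‖ ≤ q * ‖x‖) : Expanding A := by
  obtain ⟨K, hK⟩ : ∃ K, ∀ s ∈ Set.Icc (-T) 0, ‖flow A s‖ ≤ K :=
    isCompact_Icc.exists_bound_of_continuousOn (continuous_flow A).continuousOn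
  have hiter : ∀ (n : ℕ) (x : V), ‖flow A (-(n * T)) x‖ ≤ q ^ n * ‖x‖ := by
    intro n
    induction n with
    | zero => simp
    | succ n ih =>
      intro x
      have : (-(((n + 1 : ℕ) : ℝ) * T)) = -(n * T) + -T := by push_cast; ring
      rw [this, flow_add_apply, pow_succ, mul_assoc]
      exact (ih _).trans (by gcongr; exact h x)
  have hK0 : 0 ≤ K := (norm_nonneg _).trans (hK 0 ⟨by linarith, le_rfl⟩)
  -- The rate is chosen so that the exponential equals q^(s/T). Rounding s/T down to n costs at most
  -- one factor q⁻¹, and the remaining time lies in [0, T], where K bounds the backward flow.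
  refine ⟨K / q, -Real.log q / T, div_pos (neg_pos.2 (Real.log_neg hq0 hq)) hT, fun s hs x => ?_⟩
  set n := ⌊s / T⌋₊ with hn
  have h1 : (n : ℝ) ≤ s / T := Nat.floor_le (by positivity)
  have h2 : s / T < n + 1 := Nat.lt_floor_add_one _
  have h3 : n * T ≤ s := (le_div_iff₀ hT).1 h1
  have h4 : s < (n + 1) * T := (div_lt_iff₀ hT).1 h2
  have e : -s = -(s - n * T) + -(n * T) := by ring
  rw [e, flow_add_apply]
  have h5 : q ^ n ≤ q⁻¹ * Real.exp (-(-Real.log q / T * s)) := by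
    have e1 : q ^ n = Real.exp (n * Real.log q) := by rw [Real.exp_nat_mul, Real.exp_log hq0]
    have e2 : q⁻¹ = Real.exp (- Real.log q) := by rw [Real.exp_neg, Real.exp_log hq0]
    rw [e1, e2, ← Real.exp_add]
    apply Real.exp_le_exp.2
    have e3 : -(-Real.log q / T * s) = s / T * Real.log q := by ring
    rw [e3]
    nlinarith [Real.log_neg hq0 hq]
  calc _ ≤ K * ‖flow A (-(n * T)) x‖ := (ContinuousLinearMap.le_opNorm _ _).trans (by
          gcongr
          exact hK _ ⟨by linarith, by linarith⟩)
    _ ≤ K * (q ^ n * ‖x‖) := by gcongr; exact hiter n x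
    _ ≤ K * ((q⁻¹ * Real.exp (-(-Real.log q / T * s))) * ‖x‖) := by gcongr
    _ = _ := by ring

end Expanding

/-! ### Gauges, clocks and extension along orbits -/

section Gauge

variable {V W : Type*} [NormedAddCommGroup V] [NormedSpace ℝ V] [CompleteSpace V]
  [NormedAddCommGroup W] [NormedSpace ℝ W] [CompleteSpace W]

/-- A continuous positive function that dominates the norm and decays exponentially along the
backward flow of `B`. -/
structure IsGauge (B : W →L[ℝ] W) (ρ : W → ℝ) : Prop where
  continuous : Continuous ρ
  zero : ρ 0 = 0
  pos : ∀ w, w ≠ 0 → 0 < ρ w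
  norm_le : ∀ w, ‖w‖ ≤ ρ w
  decay : ∃ r, 0 < r ∧ ∀ t, 0 ≤ t → ∀ w, ρ (flow B (-t) w) ≤ Real.exp (-(r * t)) * ρ w

/-- An expanding field `B` has a gauge, which is also a gauge for the field `1`. -/
theorem Expanding.exists_isGauge {B : W →L[ℝ] W} (hB : Expanding B) :
    ∃ ρ : W → ℝ, IsGauge B ρ ∧ IsGauge (1 : W →L[ℝ] W) ρ := by
  obtain ⟨K, r, hK, hr, hb⟩ := hB.bound
  -- The supremum over s of these weighted norms is an adapted norm: moving back by t shifts s to s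
  -- + t and releases the factor exp(-r t). Homogeneity makes the same function decay along the
  -- field 1.
  set f : W → Set.Ici (0 : ℝ) → ℝ := fun w s => Real.exp (r * s) * ‖flow B (-s) w‖ with hf
  have hle : ∀ w s, f w s ≤ K * ‖w‖ := by
    intro w s
    calc f w s ≤ Real.exp (r * s) * (K * Real.exp (-(r * s)) * ‖w‖) := by
          simp only [hf]; gcongr; exact hb s s.2 w
      _ = (Real.exp (r * s) * Real.exp (-(r * s))) * (K * ‖w‖) := by ring
      _ = K * ‖w‖ := by rw [← Real.exp_add]; simp
  have hbdd : ∀ w, BddAbove (Set.range (f w)) := fun w => ⟨K * ‖w‖, by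
    rintro _ ⟨s, rfl⟩; exact hle w s⟩
  have : Nonempty (Set.Ici (0 : ℝ)) := ⟨⟨0, Set.self_mem_Ici⟩⟩
  set ρ : W → ℝ := fun w => ⨆ s, f w s with hρ
  have hnorm : ∀ w, ‖w‖ ≤ ρ w := fun w => by
    have := le_ciSup (hbdd w) ⟨0, Set.self_mem_Ici⟩
    simpa [hf] using this
  have hub : ∀ w, ρ w ≤ K * ‖w‖ := fun w => ciSup_le (hle w)
  have hadd : ∀ v w, ρ (v + w) ≤ ρ v + ρ w := fun v w => ciSup_le fun s => by
    calc f (v + w) s ≤ f v s + f w s := by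
          simp only [hf, map_add, ← mul_add]; gcongr; exact norm_add_le _ _
      _ ≤ _ := add_le_add (le_ciSup (hbdd v) s) (le_ciSup (hbdd w) s)
  have hzero : ρ 0 = 0 := le_antisymm (by simpa using hub 0) (by simpa using hnorm 0)
  have hpos : ∀ w, w ≠ 0 → 0 < ρ w := fun w hw => (norm_pos_iff.2 hw).trans_le (hnorm w)
  have hcont : Continuous ρ := by
    -- Subadditivity together with ρ ≤ K‖·‖ yields the Lipschitz constant K.
    have hlip : LipschitzWith ⟨K, hK⟩ ρ := by
      refine LipschitzWith.of_le_add_mul _ fun v w => ?_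
      have := hadd w (v - w)
      rw [add_sub_cancel] at this
      rw [dist_eq_norm]
      exact this.trans (add_le_add_right (hub _) _)
    exact hlip.continuous
  refine ⟨ρ, ⟨hcont, hzero, hpos, hnorm, r, hr, fun t ht w => ciSup_le fun s => ?_⟩,
    ⟨hcont, hzero, hpos, hnorm, 1, one_pos, fun t ht w => ciSup_le fun s => ?_⟩⟩
  · have h1 := le_ciSup (hbdd w) ⟨s + t, add_nonneg s.2 ht⟩
    calc f (flow B (-t) w) s = Real.exp (-(r * t)) * f w ⟨s + t, add_nonneg s.2 ht⟩ := by
          simp only [hf]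
          rw [← flow_add_apply, ← mul_assoc, ← Real.exp_add]
          congr 2
          · ring
          · rw [neg_add]
      _ ≤ _ := by gcongr
  · have h1 := le_ciSup (hbdd w) s
    calc f (flow 1 (-t) w) s = Real.exp (-(1 * t)) * f w s := by
          simp only [hf]
          rw [flow_one_field, map_smul, norm_smul, Real.norm_eq_abs, Real.abs_exp, one_mul]
          ring
      _ ≤ _ := by gcongr

namespace IsGauge

variable {B : W →L[ℝ] W} {ρ : W → ℝ}

theorem strictAnti (h : IsGauge B ρ) {w : W} (hw : w ≠ 0) :
    StrictAnti fun t => ρ (flow B (-t) w) := by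
  obtain ⟨r, hr, hd⟩ := h.decay
  intro s t hst
  have h1 := hd (t - s) (by linarith) (flow B (-s) w)
  rw [← flow_add_apply] at h1
  have e : -(t - s) + -s = -t := by ring
  rw [e] at h1
  have h2 := h.pos _ (flow_ne_zero B (-s) hw)
  have h3 : Real.exp (-(r * (t - s))) < 1 := by
    rw [Real.exp_lt_one_iff]
    nlinarith
  simp only
  nlinarith

theorem continuous_flow_neg (h : IsGauge B ρ) (w : W) : Continuous fun t => ρ (flow B (-t) w) :=
  h.continuous.comp ((continuous_flow_apply B).comp (continuous_neg.prodMk continuous_const))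

/-- Intermediate value theorem: decay forces values at most 1 at some backward time and at least 1
at some forward time. The time |log ρ(w)|/r is just long enough for the decay factor to offset ρ(w).
-/
theorem exists_clock (h : IsGauge B ρ) {w : W} (hw : w ≠ 0) : ∃ t, ρ (flow B (-t) w) = 1 := by
  obtain ⟨r, hr, hd⟩ := h.decay
  have hp := h.pos w hw
  obtain ⟨a, ha⟩ : ∃ a, ρ (flow B (-a) w) ≤ 1 := by
    refine ⟨|Real.log (ρ w)| / r, (hd _ (by positivity) w).trans ?_⟩
    have e : r * (|Real.log (ρ w)| / r) = |Real.log (ρ w)| := by field_simp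
    rw [e]
    nth_rewrite 2 [← Real.exp_log hp]
    rw [← Real.exp_add, Real.exp_le_one_iff]
    linarith [le_abs_self (Real.log (ρ w))]
  obtain ⟨b, hb⟩ : ∃ b, 1 ≤ ρ (flow B (-b) w) := by
    set t := |Real.log (ρ w)| / r with ht
    refine ⟨-t, ?_⟩
    have h1 := hd t (by positivity) (flow B t w)
    rw [flow_neg_apply_flow] at h1
    have e : r * t = |Real.log (ρ w)| := by rw [ht]; field_simp
    rw [e] at h1
    rw [neg_neg]
    have h2 : Real.exp (-|Real.log (ρ w)|) ≤ ρ w := by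
      nth_rewrite 2 [← Real.exp_log hp]
      exact Real.exp_le_exp.2 (neg_abs_le _)
    have h3 := h2.trans h1
    have h4 := Real.exp_pos (-|Real.log (ρ w)|)
    nlinarith
  exact mem_range_of_exists_le_of_exists_ge (h.continuous_flow_neg w) ⟨a, ha⟩ ⟨b, hb⟩

end IsGauge

open Classical in
/-- The time at which the orbit of `B` through the unit level set of `ρ` reaches `w`. -/
noncomputable def clock (B : W →L[ℝ] W) (ρ : W → ℝ) (w : W) : ℝ :=
  if h : ∃ t, ρ (flow B (-t) w) = 1 then h.choose else 0

namespace IsGauge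

variable {B : W →L[ℝ] W} {ρ : W → ℝ}

theorem flow_neg_clock (h : IsGauge B ρ) {w : W} (hw : w ≠ 0) :
    ρ (flow B (-clock B ρ w) w) = 1 := by
  have he := h.exists_clock hw
  rw [clock, dif_pos he]
  exact he.choose_spec

theorem clock_eq (h : IsGauge B ρ) {w : W} (hw : w ≠ 0) {t : ℝ} (ht : ρ (flow B (-t) w) = 1) :
    clock B ρ w = t :=
  (h.strictAnti hw).injective ((h.flow_neg_clock hw).trans ht.symm)

theorem clock_flow (h : IsGauge B ρ) {w : W} (hw : w ≠ 0) (t : ℝ) :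
    clock B ρ (flow B t w) = t + clock B ρ w := by
  refine h.clock_eq (flow_ne_zero B t hw) ?_
  rw [← flow_add_apply]
  convert h.flow_neg_clock hw using 4
  ring

theorem clock_lt_iff (h : IsGauge B ρ) {w : W} (hw : w ≠ 0) {a : ℝ} :
    clock B ρ w < a ↔ ρ (flow B (-a) w) < 1 := by
  rw [← h.flow_neg_clock hw]
  exact (h.strictAnti hw).lt_iff_gt.symm

theorem lt_clock_iff (h : IsGauge B ρ) {w : W} (hw : w ≠ 0) {a : ℝ} :
    a < clock B ρ w ↔ 1 < ρ (flow B (-a) w) := by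
  rw [← h.flow_neg_clock hw]
  exact (h.strictAnti hw).lt_iff_gt.symm

/-- By monotonicity along orbits, comparing the clock with a fixed a amounts to comparing ρ(flow B
(-a) v) with 1, an open condition on v. -/
theorem continuousAt_clock (h : IsGauge B ρ) {w : W} (hw : w ≠ 0) :
    ContinuousAt (clock B ρ) w := by
  have hne : ∀ᶠ v in 𝓝 w, v ≠ 0 := isOpen_ne.mem_nhds hw
  have hc : ∀ a, Continuous fun v => ρ (flow B (-a) v) := fun a =>
    h.continuous.comp (flow B (-a)).continuous
  refine tendsto_order.2 ⟨fun a ha => ?_, fun a ha => ?_⟩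
  · filter_upwards [hne, (hc a).continuousAt.eventually_const_lt ((h.lt_clock_iff hw).1 ha)]
      with v hv hv' using (h.lt_clock_iff hv).2 hv'
  · filter_upwards [hne, (hc a).continuousAt.eventually_lt_const ((h.clock_lt_iff hw).1 ha)]
      with v hv hv' using (h.clock_lt_iff hv).2 hv'

theorem tendsto_clock (h : IsGauge B ρ) : Tendsto (clock B ρ) (𝓝[≠] 0) atBot := by
  refine tendsto_atBot.2 fun a => ?_
  have hc : Continuous fun v => ρ (flow B (-a) v) := h.continuous.comp (flow B (-a)).continuous
  have h1 : ∀ᶠ v in 𝓝 (0 : W), ρ (flow B (-a) v) < 1 :=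
    hc.continuousAt.eventually_lt_const (by simp [h.zero])
  filter_upwards [h1.filter_mono nhdsWithin_le_nhds, self_mem_nhdsWithin] with v hv hv'
  exact ((h.clock_lt_iff hv').2 hv).le

end IsGauge

open Classical in
/-- The extension of the linear map `s` from the unit level set of `ρ` to a map that carries the
flow of `B` to the flow of `A`. -/
noncomputable def flowExtend (A : V →L[ℝ] V) (B : W →L[ℝ] W) (ρ : W → ℝ) (s : W →L[ℝ] V) (w : W) :
    V :=
  if w = 0 then 0 else flow A (clock B ρ w) (s (flow B (-clock B ρ w) w))

@[simp] theorem flowExtend_zero (A : V →L[ℝ] V) (B : W →L[ℝ] W) (ρ : W → ℝ) (s : W →L[ℝ] V) :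
    flowExtend A B ρ s 0 = 0 := if_pos rfl

theorem flowExtend_of_ne_zero (A : V →L[ℝ] V) (B : W →L[ℝ] W) (ρ : W → ℝ) (s : W →L[ℝ] V) {w : W}
    (hw : w ≠ 0) :
    flowExtend A B ρ s w = flow A (clock B ρ w) (s (flow B (-clock B ρ w) w)) := if_neg hw

namespace IsGauge

variable {A : V →L[ℝ] V} {B : W →L[ℝ] W} {ρ : W → ℝ}

theorem flowExtend_flow (h : IsGauge B ρ) (A : V →L[ℝ] V) (s : W →L[ℝ] V) (t : ℝ) (w : W) :
    flowExtend A B ρ s (flow B t w) = flow A t (flowExtend A B ρ s w) := by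
  by_cases hw : w = 0
  · simp [hw]
  · rw [flowExtend_of_ne_zero _ _ _ _ (flow_ne_zero B t hw), flowExtend_of_ne_zero _ _ _ _ hw,
      h.clock_flow hw, flow_add_apply, ← flow_add_apply B]
    congr 5
    ring

/-- Only the origin is delicate. There the clock tends to −∞, the point on the level set has norm at
most 1, so its image under s is bounded by ‖s‖, and the backward flow of A contracts it to 0. -/
theorem continuous_flowExtend (h : IsGauge B ρ) (hA : Expanding A) (s : W →L[ℝ] V) :
    Continuous (flowExtend A B ρ s) := by
  refine continuous_iff_continuousAt.2 fun w => ?_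
  by_cases hw : w = 0
  · subst hw
    rw [continuousAt_iff_punctured_nhds, flowExtend_zero]
    obtain ⟨K, r, hK, hr, hb⟩ := hA.bound
    have hlim : Tendsto (fun w => K * Real.exp (r * clock B ρ w) * ‖s‖) (𝓝[≠] 0) (𝓝 0) := by
      have := Real.tendsto_exp_atBot.comp (h.tendsto_clock.const_mul_atBot hr)
      simpa using (this.const_mul K).mul_const ‖s‖
    refine squeeze_zero_norm' ?_ hlim
    filter_upwards [self_mem_nhdsWithin, h.tendsto_clock.eventually (eventually_le_atBot 0)]
      with w hw hτ
    rw [flowExtend_of_ne_zero _ _ _ _ hw]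
    have h1 := hb (-clock B ρ w) (by linarith) (s (flow B (-clock B ρ w) w))
    rw [neg_neg, mul_neg, neg_neg] at h1
    refine h1.trans ?_
    gcongr
    refine (s.le_opNorm _).trans ?_
    have := h.norm_le (flow B (-clock B ρ w) w)
    rw [h.flow_neg_clock hw] at this
    exact mul_le_of_le_one_right (norm_nonneg _) this
  · have hc := h.continuousAt_clock hw
    have h1 : ContinuousAt (fun w => flow A (clock B ρ w) (s (flow B (-clock B ρ w) w))) w :=
      (continuous_flow_apply A).continuousAt.comp₂ hc <| s.continuous.continuousAt.comp <|
        (continuous_flow_apply B).continuousAt.comp₂ hc.neg continuousAt_id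
    refine h1.congr ?_
    filter_upwards [isOpen_ne.mem_nhds hw] with v hv
    exact (flowExtend_of_ne_zero _ _ _ _ hv).symm

/-- Sharing one gauge gives both flows the same unit level set, so w and its image have the same
clock and the same starting point there. -/
theorem flowExtend_flowExtend {A B : W →L[ℝ] W} (hA : IsGauge A ρ) (hB : IsGauge B ρ) (w : W) :
    flowExtend B A ρ 1 (flowExtend A B ρ 1 w) = w := by
  by_cases hw : w = 0
  · simp [hw]
  have hu := flow_ne_zero B (-clock B ρ w) hw
  rw [flowExtend_of_ne_zero _ _ _ _ hw]
  change flowExtend B A ρ 1 (flow A (clock B ρ w) (flow B (-clock B ρ w) w)) = w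
  have hne := flow_ne_zero A (clock B ρ w) hu
  have hcl : clock A ρ (flow A (clock B ρ w) (flow B (-clock B ρ w) w)) = clock B ρ w :=
    hA.clock_eq hne (by rw [flow_neg_apply_flow, hB.flow_neg_clock hw])
  rw [flowExtend_of_ne_zero _ _ _ _ hne, hcl, flow_neg_apply_flow]
  exact flow_apply_flow_neg B _ w

end IsGauge

/-- The flow of an expanding field is topologically conjugate to the flow of the field `1`. -/
theorem Expanding.exists_homeomorph {B : W →L[ℝ] W} (hB : Expanding B) :
    ∃ g : W ≃ₜ W, ∀ t w, g (flow B t w) = flow 1 t (g w) := by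
  obtain ⟨ρ, h1, h2⟩ := hB.exists_isGauge
  exact ⟨{ toFun := flowExtend 1 B ρ 1
           invFun := flowExtend B 1 ρ 1
           left_inv := h2.flowExtend_flowExtend h1
           right_inv := h1.flowExtend_flowExtend h2
           continuous_toFun := h1.continuous_flowExtend expanding_one 1
           continuous_invFun := h2.continuous_flowExtend hB 1 },
    fun t w => h1.flowExtend_flow 1 1 t w⟩

/-- A linear semiconjugacy between expanding fields has a continuous equivariant section. -/
theorem Expanding.exists_section {A : V →L[ℝ] V} {B : W →L[ℝ] W} (hA : Expanding A)
    (hB : Expanding B) (π : V →L[ℝ] W) (s : W →L[ℝ] V) (hs : ∀ w, π (s w) = w)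
    (hπ : ∀ x, π (A x) = B (π x)) :
    ∃ Φ : W → V, Continuous Φ ∧ (∀ w, π (Φ w) = w) ∧
      ∀ t w, Φ (flow B t w) = flow A t (Φ w) := by
  obtain ⟨ρ, h, -⟩ := hB.exists_isGauge
  refine ⟨flowExtend A B ρ s, h.continuous_flowExtend hA s, fun w => ?_,
    fun t w => h.flowExtend_flow A s t w⟩
  by_cases hw : w = 0
  · simp [hw]
  · rw [flowExtend_of_ne_zero _ _ _ _ hw, flow_intertwine π hπ, hs, flow_apply_flow_neg]

end Gauge

/-! ### From eigenvalues to exponential decay -/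

section SpectralDecay

variable {ι : Type*} [Fintype ι] [DecidableEq ι]

/-- A matrix as a continuous linear map. -/
noncomputable def matrixCLM {κ : Type*} [Fintype κ] (A : Matrix κ ι ℝ) : (ι → ℝ) →L[ℝ] (κ → ℝ) :=
  LinearMap.toContinuousLinearMap A.mulVecLin

@[simp] theorem matrixCLM_apply {κ : Type*} [Fintype κ] (A : Matrix κ ι ℝ) (x : ι → ℝ) :
    matrixCLM A x = A.mulVec x := rfl

open NormedSpace in
theorem exp_apply_of_apply_eq_smul {E : Type*} [NormedAddCommGroup E] [NormedSpace ℂ E]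
    [CompleteSpace E] (M : E →L[ℂ] E) {μ : ℂ} {v : E} (h : M v = μ • v) :
    exp M v = Complex.exp μ • v := by
  have hp : ∀ n : ℕ, (M ^ n) v = μ ^ n • v := by
    intro n
    induction n with
    | zero => simp
    | succ n ih =>
      rw [pow_succ, mul_apply_eq_comp, h, map_smul, ih, smul_smul, pow_succ']
  have h1 := (exp_series_hasSum_exp' (𝕂 := ℂ) M).mapL (ContinuousLinearMap.apply ℂ E v)
  have h2 := ((exp_series_hasSum_exp' (𝕂 := ℂ) μ).smul_const v)
  rw [← Complex.exp_eq_exp_ℂ] at h2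
  refine h1.unique ?_
  have : (fun n : ℕ => (ContinuousLinearMap.apply ℂ E v) ((n.factorial : ℂ)⁻¹ • M ^ n)) =
      fun n : ℕ => ((n.factorial : ℂ)⁻¹ • μ ^ n) • v := by
    funext n
    simp only [map_smul, ContinuousLinearMap.apply_apply, hp, smul_smul, smul_eq_mul]
  rw [this]
  exact h2

/-- Every eigenvalue of `exp M` is the exponential of an eigenvalue of `M`. -/
theorem exists_eigenvalue_of_mem_spectrum_exp {E : Type*} [NormedAddCommGroup E] [NormedSpace ℂ E]
    [FiniteDimensional ℂ E] (M : E →L[ℂ] E) {ν : ℂ} (hν : ν ∈ spectrum ℂ (NormedSpace.exp M)) :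
    ∃ μ : ℂ, ∃ v : E, v ≠ 0 ∧ M v = μ • v ∧ Complex.exp μ = ν := by
  have := FiniteDimensional.complete ℂ E
  obtain ⟨w, hw, hw0⟩ : ∃ w : E, NormedSpace.exp M w = ν • w ∧ w ≠ 0 := by
    by_contra! hcon
    have hinj : Function.Injective (algebraMap ℂ (E →L[ℂ] E) ν - NormedSpace.exp M) := by
      refine (injective_iff_map_eq_zero _).2 fun w hw => hcon w ?_
      have : ν • w - NormedSpace.exp M w = 0 := by
        simpa [Algebra.algebraMap_eq_smul_one] using hw
      exact (sub_eq_zero.1 this).symm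
    have hbij : Function.Bijective (algebraMap ℂ (E →L[ℂ] E) ν - NormedSpace.exp M) :=
      ⟨hinj, LinearMap.surjective_of_injective
        (f := ((algebraMap ℂ (E →L[ℂ] E) ν - NormedSpace.exp M : E →L[ℂ] E) : E →ₗ[ℂ] E)) hinj⟩
    exact hν (ContinuousLinearMap.isUnit_iff_bijective.2 hbij)
  -- The ν-eigenspace of exp M is nonzero and M-invariant, so M has an eigenvector inside it; its
  -- eigenvalue must exponentiate to ν.
  set F : Submodule ℂ E :=
    Module.End.eigenspace ((NormedSpace.exp M : E →L[ℂ] E) : E →ₗ[ℂ] E) ν with hF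
  have hcomm : ∀ x, NormedSpace.exp M (M x) = M (NormedSpace.exp M x) := by
    intro x
    have : Commute (NormedSpace.exp M) M := (Commute.refl M).exp_left
    exact DFunLike.congr_fun this.eq x
  have hFM : ∀ x ∈ F, (M : E →ₗ[ℂ] E) x ∈ F := by
    intro x hx
    rw [hF, Module.End.mem_eigenspace_iff] at hx ⊢
    change NormedSpace.exp M x = ν • x at hx
    change NormedSpace.exp M (M x) = ν • M x
    rw [hcomm, hx, map_smul]
  have hwF : w ∈ F := Module.End.mem_eigenspace_iff.2 hw
  have : Nontrivial F := ⟨⟨⟨w, hwF⟩, 0, fun h => hw0 (congrArg Subtype.val h)⟩⟩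
  obtain ⟨μ, hμ⟩ := Module.End.exists_eigenvalue ((M : E →ₗ[ℂ] E).restrict hFM)
  obtain ⟨v, hv⟩ := hμ.exists_hasEigenvector
  have hMv : M v = μ • (v : E) := congrArg Subtype.val hv.apply_eq_smul
  have hv0 : (v : E) ≠ 0 := fun h => hv.2 (Subtype.ext h)
  refine ⟨μ, v, hv0, hMv, ?_⟩
  have h1 := exp_apply_of_apply_eq_smul M hMv
  have h2 : NormedSpace.exp M (v : E) = ν • (v : E) := Module.End.mem_eigenspace_iff.1 v.2
  exact smul_left_injective ℂ hv0 (h1.symm.trans h2)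

theorem mem_spectrum_of_mulVec_eq {M : Matrix ι ι ℂ} {μ : ℂ} {v : ι → ℂ} (hv : v ≠ 0)
    (h : M.mulVec v = μ • v) : μ ∈ spectrum ℂ M := by
  rw [← Matrix.spectrum_toLin']
  exact (Module.End.hasEigenvalue_of_hasEigenvector (x := v)
    ⟨Module.End.mem_eigenspace_iff.2 (by simpa using h), hv⟩).mem_spectrum

/-- If all eigenvalues have positive real part, the field is expanding. -/
theorem expanding_matrixCLM {A : Matrix ι ι ℝ}
    (h : ∀ μ ∈ spectrum ℂ (A.map (algebraMap ℝ ℂ)), 0 < μ.re) : Expanding (matrixCLM A) := by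
  cases isEmpty_or_nonempty ι with
  | inl hι => exact ⟨0, 1, one_pos, fun s _ x => by
      rw [Subsingleton.elim (flow (matrixCLM A) (-s) x) 0]; simp⟩
  | inr hι =>
  set M : (ι → ℂ) →L[ℂ] (ι → ℂ) :=
    LinearMap.toContinuousLinearMap (A.map (algebraMap ℝ ℂ)).mulVecLin with hM
  have hρ : spectralRadius ℂ (NormedSpace.exp (-M)) < 1 := by
    refine spectrum.spectralRadius_lt_of_forall_lt _ fun ν hν => ?_
    obtain ⟨μ, v, hv0, hv, rfl⟩ := exists_eigenvalue_of_mem_spectrum_exp (-M) hν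
    have hv' : (A.map (algebraMap ℝ ℂ)).mulVec v = (-μ) • v := by
      have : -(M v) = μ • v := hv
      rw [neg_smul, ← this, neg_neg]
      rfl
    have := h _ (mem_spectrum_of_mulVec_eq hv0 hv')
    rw [← NNReal.coe_lt_coe, coe_nnnorm, Complex.norm_exp]
    simpa using this
  -- Gelfand's formula turns spectral radius below 1 into a contracting power.
  obtain ⟨n, hn0, hn⟩ : ∃ n : ℕ, 0 < n ∧ ‖NormedSpace.exp (-M) ^ n‖₊ < 1 := by
    have h1 := spectrum.pow_nnnorm_pow_one_div_tendsto_nhds_spectralRadius (NormedSpace.exp (-M))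
    obtain ⟨n, hn, hn'⟩ := ((h1.eventually_lt_const hρ).and (eventually_gt_atTop 0)).exists
    refine ⟨n, hn', ?_⟩
    by_contra! hcon
    refine hn.not_ge (ENNReal.one_le_rpow ?_ (by positivity))
    exact_mod_cast hcon
  -- The isometric inclusion of real into complex vectors carries the contraction back to the real
  -- flow.
  set f : (ι → ℝ) →L[ℝ] (ι → ℂ) := LinearMap.toContinuousLinearMap
    { toFun := fun x i => (x i : ℂ)
      map_add' := fun x y => by ext i; simp
      map_smul' := fun c x => by ext i; simp } with hf
  have hfn : ∀ x, ‖f x‖ = ‖x‖ := by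
    intro x
    simp only [Pi.norm_def]
    congr 2
    ext i
    simp [hf]
  have hfA : ∀ x, f (matrixCLM A x) = (M.restrictScalars ℝ) (f x) := by
    intro x
    ext i
    simp [hf, hM, Matrix.mulVec, dotProduct]
  have hflow : ∀ (n : ℕ) x, f (flow (matrixCLM A) (-(n * 1)) x) = (NormedSpace.exp (-M) ^ n) (f x) := by
    have hp : ∀ (n : ℕ) (x : ι → ℝ),
        f ((((-1 : ℝ) • matrixCLM A) ^ n) x) = ((-M) ^ n) (f x) := by
      intro n
      induction n with
      | zero => simp
      | succ n ih =>
        intro x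
        rw [pow_succ, pow_succ, mul_apply_eq_comp, mul_apply_eq_comp, ih]
        congr 1
        have := hfA x
        simp only [ContinuousLinearMap.coe_restrictScalars'] at this
        rw [smul_apply, map_smul, this]
        simp
    have h1 : ∀ x, f (flow (matrixCLM A) (-1) x) = NormedSpace.exp (-M) (f x) := by
      intro x
      have h1 := (NormedSpace.exp_series_hasSum_exp' (𝕂 := ℝ) ((-1 : ℝ) • matrixCLM A)).mapL
        (f ∘L (ContinuousLinearMap.apply ℝ (ι → ℝ) x))
      have h2 := (NormedSpace.exp_series_hasSum_exp' (𝕂 := ℂ) (-M)).mapL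
        (ContinuousLinearMap.apply ℂ (ι → ℂ) (f x))
      refine h1.unique ?_
      have : (fun n : ℕ =>
          (f ∘L ContinuousLinearMap.apply ℝ (ι → ℝ) x)
            ((n.factorial : ℝ)⁻¹ • ((-1 : ℝ) • matrixCLM A) ^ n)) =
          fun n : ℕ => (ContinuousLinearMap.apply ℂ (ι → ℂ) (f x))
            ((n.factorial : ℂ)⁻¹ • (-M) ^ n) := by
        funext n
        simp only [map_smul, ContinuousLinearMap.apply_apply, ContinuousLinearMap.comp_apply, hp]
        rw [← Complex.coe_smul]
        simp
      rw [this]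
      exact h2
    intro n
    induction n with
    | zero => simp
    | succ n ih =>
      intro x
      have e : (-(((n + 1 : ℕ) : ℝ) * 1)) = -(n * 1) + -1 := by push_cast; ring
      rw [e, flow_add_apply, ih, h1, pow_succ]
      rfl
  -- The midpoint between the norm and 1 keeps the factor strictly positive.
  refine expanding_of_contraction (T := n * 1) (q := (‖NormedSpace.exp (-M) ^ n‖ + 1) / 2)
    (by positivity) (by positivity) ?_ fun x => ?_
  · have : ‖NormedSpace.exp (-M) ^ n‖ < 1 := hn
    linarith
  · have : ‖NormedSpace.exp (-M) ^ n‖ < 1 := hn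
    rw [← hfn, hflow, ← hfn x]
    refine (ContinuousLinearMap.le_opNorm _ _).trans ?_
    gcongr
    linarith

end SpectralDecay

/-! ### Output jets and observability -/

section Observation

variable {V W Y : Type*} [NormedAddCommGroup V] [NormedSpace ℝ V]
  [NormedAddCommGroup W] [NormedSpace ℝ W] [NormedAddCommGroup Y] [NormedSpace ℝ Y]

/-- The map `x ↦ (C x, C A x, C A² x, …)`. -/
noncomputable def obsMap (A : V →L[ℝ] V) (C : V →L[ℝ] Y) : V →ₗ[ℝ] (ℕ → Y) :=
  LinearMap.pi fun j => ((C ∘L A ^ j : V →L[ℝ] Y) : V →ₗ[ℝ] Y)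

theorem obsMap_apply (A : V →L[ℝ] V) (C : V →L[ℝ] Y) (x : V) (j : ℕ) :
    obsMap A C x j = C ((A ^ j) x) := rfl

theorem obsMap_apply_field (A : V →L[ℝ] V) (C : V →L[ℝ] Y) (x : V) (j : ℕ) :
    obsMap A C (A x) j = obsMap A C x (j + 1) := by
  rw [obsMap_apply, obsMap_apply, pow_succ, mul_apply_eq_comp]

theorem aeval_intertwine {A : V →L[ℝ] V} {B : W →L[ℝ] W} (f : V →L[ℝ] W)
    (h : ∀ x, f (A x) = B (f x)) (P : Polynomial ℝ) (x : V) :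
    f (Polynomial.aeval A P x) = Polynomial.aeval B P (f x) := by
  have hp : ∀ (n : ℕ) (x : V), f ((A ^ n) x) = (B ^ n) (f x) := by
    intro n
    induction n with
    | zero => simp
    | succ n ih =>
      intro x
      rw [pow_succ, pow_succ, mul_apply_eq_comp, mul_apply_eq_comp, ih, h]
  induction P using Polynomial.induction_on' with
  | add P Q hP hQ => simp only [map_add, add_apply, hP, hQ]
  | monomial n a =>
    simp only [Polynomial.aeval_monomial, Algebra.algebraMap_eq_smul_one, smul_mul_assoc, one_mul,
      smul_apply, map_smul, hp]

theorem obsMap_intertwine {A : V →L[ℝ] V} {B : W →L[ℝ] W} {C : V →L[ℝ] Y} {D : W →L[ℝ] Y}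
    (f : V →L[ℝ] W) (h : ∀ x, f (A x) = B (f x)) (hC : ∀ x, D (f x) = C x) (x : V) :
    obsMap B D (f x) = obsMap A C x := by
  funext j
  have := aeval_intertwine f h (Polynomial.X ^ j) x
  simp only [map_pow, Polynomial.aeval_X] at this
  rw [obsMap_apply, obsMap_apply, ← this, hC]

/-- Two observable linear systems with the same set of output jets are linearly isomorphic. -/
theorem exists_linearEquiv_of_range_obsMap_eq {A : V →L[ℝ] V} {B : W →L[ℝ] W} {C : V →L[ℝ] Y}
    {D : W →L[ℝ] Y} (hA : Function.Injective (obsMap A C)) (hB : Function.Injective (obsMap B D))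
    (h : LinearMap.range (obsMap A C) = LinearMap.range (obsMap B D)) :
    ∃ M : V ≃ₗ[ℝ] W, (∀ x, M (A x) = B (M x)) ∧ ∀ x, D (M x) = C x := by
  set M : V ≃ₗ[ℝ] W := (LinearEquiv.ofInjective _ hA).trans
    ((LinearEquiv.ofEq _ _ h).trans (LinearEquiv.ofInjective _ hB).symm) with hM
  have key : ∀ x, obsMap B D (M x) = obsMap A C x := by
    intro x
    have : LinearEquiv.ofInjective _ hB (M x) =
        LinearEquiv.ofEq _ _ h (LinearEquiv.ofInjective _ hA x) := by
      simp [hM]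
    exact congrArg Subtype.val this
  refine ⟨M, fun x => hB ?_, fun x => ?_⟩
  · funext j
    rw [key, obsMap_apply_field, obsMap_apply_field, key]
  · simpa [obsMap_apply] using congrFun (key x) 0

/-- Write a f + b g = 1. Multiples of g kill y, so (b g)(A) x has zero output jet and vanishes by
observability; (a f)(A) x vanishes because f annihilates A. Their sum is x. -/
theorem eq_zero_of_isCoprime {A : V →L[ℝ] V} {B : W →L[ℝ] W} {C : V →L[ℝ] Y} {D : W →L[ℝ] Y}
    (hA : Function.Injective (obsMap A C)) {f g : Polynomial ℝ} (hf : Polynomial.aeval A f = 0)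
    (hg : Polynomial.aeval B g = 0) (hfg : IsCoprime f g) {x : V} {y : W}
    (h : ∀ P : Polynomial ℝ, C (Polynomial.aeval A P x) + D (Polynomial.aeval B P y) = 0) :
    x = 0 := by
  obtain ⟨a, b, hab⟩ := hfg
  have h1 : Polynomial.aeval A (b * g) x = 0 := by
    apply hA
    rw [map_zero]
    funext j
    have := h (Polynomial.X ^ j * (b * g))
    have h0 : Polynomial.aeval B (Polynomial.X ^ j * (b * g)) = 0 := by simp [hg]
    rw [h0, zero_apply, map_zero, add_zero, map_mul, map_pow, Polynomial.aeval_X,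
      mul_apply_eq_comp] at this
    exact this
  have h2 : Polynomial.aeval A (a * f) x = 0 := by simp [hf]
  have h3 := congrArg (fun P => Polynomial.aeval A P x) hab
  simpa only [map_add, add_apply, h1, h2, map_one, one_apply_eq_self, add_zero, eq_comm] using h3

/-- The sum of two observable systems annihilated by coprime polynomials is observable. -/
theorem obsMap_coprod_injective {A : V →L[ℝ] V} {B : W →L[ℝ] W} {C : V →L[ℝ] Y} {D : W →L[ℝ] Y}
    (hA : Function.Injective (obsMap A C)) (hB : Function.Injective (obsMap B D))
    {f g : Polynomial ℝ} (hf : Polynomial.aeval A f = 0)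
    (hg : Polynomial.aeval B g = 0) (hfg : IsCoprime f g) :
    Function.Injective (obsMap (A.prodMap B) (C.coprod D)) := by
  refine (injective_iff_map_eq_zero _).2 fun q hq => ?_
  have hfst := aeval_intertwine (A := A.prodMap B) (B := A) (ContinuousLinearMap.fst ℝ V W)
      (fun _ => rfl)
  have hsnd := aeval_intertwine (A := A.prodMap B) (B := B) (ContinuousLinearMap.snd ℝ V W)
      (fun _ => rfl)
  have h : ∀ P : Polynomial ℝ,
      C (Polynomial.aeval A P q.1) + D (Polynomial.aeval B P q.2) = 0 := by
    intro P
    have : (C.coprod D) (Polynomial.aeval (A.prodMap B) P q) = 0 := by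
      induction P using Polynomial.induction_on' with
      | add P Q hP hQ => rw [map_add, add_apply, map_add, hP, hQ, add_zero]
      | monomial n a =>
        simp only [Polynomial.aeval_monomial, Algebra.algebraMap_eq_smul_one, smul_mul_assoc,
          one_mul, smul_apply, map_smul]
        rw [← obsMap_apply, hq]
        simp
    rw [ContinuousLinearMap.coprod_apply] at this
    rw [← this]
    exact (congrArg₂ (fun a b => C a + D b) (hfst P q) (hsnd P q)).symm
  exact Prod.ext (eq_zero_of_isCoprime hA hf hg hfg h)
    (eq_zero_of_isCoprime hB hg hf hfg.symm fun P => (add_comm _ _).trans (h P))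

theorem aeval_prodMap_mul_eq_zero {A : V →L[ℝ] V} {B : W →L[ℝ] W}
    {f g : Polynomial ℝ} (hf : Polynomial.aeval A f = 0) (hg : Polynomial.aeval B g = 0) :
    Polynomial.aeval (A.prodMap B) (f * g) = 0 := by
  refine ContinuousLinearMap.ext fun q => ?_
  have hfst := aeval_intertwine (A := A.prodMap B) (B := A) (ContinuousLinearMap.fst ℝ V W)
      (fun _ => rfl) (f * g) q
  have hsnd := aeval_intertwine (A := A.prodMap B) (B := B) (ContinuousLinearMap.snd ℝ V W)
      (fun _ => rfl) (f * g) q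
  rw [map_mul (Polynomial.aeval A), hf, zero_mul] at hfst
  rw [map_mul (Polynomial.aeval B), hg, mul_zero] at hsnd
  exact Prod.ext hfst hsnd

end Observation

/-! ### Conjugacy of observed flows -/

section FlowConj

variable {V W X Y V' W' : Type*} [NormedAddCommGroup V] [NormedSpace ℝ V] [CompleteSpace V]
  [NormedAddCommGroup W] [NormedSpace ℝ W] [CompleteSpace W]
  [NormedAddCommGroup V'] [NormedSpace ℝ V'] [CompleteSpace V']
  [NormedAddCommGroup W'] [NormedSpace ℝ W'] [CompleteSpace W']
  [NormedAddCommGroup X] [NormedSpace ℝ X] [CompleteSpace X]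
  [NormedAddCommGroup Y] [NormedSpace ℝ Y]

/-- Topological conjugacy of the flows of two observed linear fields. -/
def FlowConj (A : V →L[ℝ] V) (C : V →L[ℝ] Y) (B : W →L[ℝ] W) (D : W →L[ℝ] Y) : Prop :=
  ∃ H : V ≃ₜ W, (∀ t x, H (flow A t x) = flow B t (H x)) ∧ ∀ x, D (H x) = C x

namespace FlowConj

variable {A : V →L[ℝ] V} {C : V →L[ℝ] Y} {B : W →L[ℝ] W} {D : W →L[ℝ] Y}
  {A' : V' →L[ℝ] V'} {C' : V' →L[ℝ] Y} {B' : W' →L[ℝ] W'} {D' : W' →L[ℝ] Y}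
  {E : X →L[ℝ] X} {G : X →L[ℝ] Y}

theorem refl (A : V →L[ℝ] V) (C : V →L[ℝ] Y) : FlowConj A C A C :=
  ⟨Homeomorph.refl V, fun _ _ => rfl, fun _ => rfl⟩

theorem symm (h : FlowConj A C B D) : FlowConj B D A C := by
  obtain ⟨H, h1, h2⟩ := h
  refine ⟨H.symm, fun t x => ?_, fun x => ?_⟩
  · rw [H.symm_apply_eq, h1, H.apply_symm_apply]
  · rw [← h2, H.apply_symm_apply]

theorem trans (h : FlowConj A C B D) (h' : FlowConj B D E G) : FlowConj A C E G := by
  obtain ⟨H, h1, h2⟩ := h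
  obtain ⟨H', h1', h2'⟩ := h'
  exact ⟨H.trans H', fun t x => by simp [h1, h1'], fun x => by simp [h2, h2']⟩

theorem prod (h : FlowConj A C B D) (h' : FlowConj A' C' B' D') :
    FlowConj (A.prodMap A') (C.coprod C') (B.prodMap B') (D.coprod D') := by
  obtain ⟨H, h1, h2⟩ := h
  obtain ⟨H', h1', h2'⟩ := h'
  exact ⟨H.prodCongr H', fun t x => by simp [flow_prodMap, h1, h1'], fun x => by simp [h2, h2']⟩

theorem neg (h : FlowConj A C B D) : FlowConj (-A) C (-B) D := by
  obtain ⟨H, h1, h2⟩ := h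
  exact ⟨H, fun t x => by rw [flow_neg_field, flow_neg_field, h1], h2⟩

theorem of_continuousLinearEquiv (M : V ≃L[ℝ] W) (h : ∀ x, M (A x) = B (M x))
    (hC : ∀ x, D (M x) = C x) : FlowConj A C B D :=
  ⟨M.toHomeomorph, fun t x => flow_intertwine (M : V →L[ℝ] W) h t x, hC⟩

theorem of_linearEquiv [FiniteDimensional ℝ V] (M : V ≃ₗ[ℝ] W) (h : ∀ x, M (A x) = B (M x))
    (hC : ∀ x, D (M x) = C x) : FlowConj A C B D :=
  of_continuousLinearEquiv M.toContinuousLinearEquiv h hC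

end FlowConj

/-- Differentiate the identity of outputs j times on [0, ∞), where one-sided derivatives are unique,
and evaluate at 0. -/
theorem obsMap_eq_of_output_eq {A : V →L[ℝ] V} {C : V →L[ℝ] Y} {B : W →L[ℝ] W} {D : W →L[ℝ] Y}
    {x : V} {y : W} (h : ∀ t, 0 ≤ t → D (flow B t y) = C (flow A t x)) :
    obsMap B D y = obsMap A C x := by
  have key : ∀ (j : ℕ) (t : ℝ), 0 ≤ t →
      D ((B ^ j) (flow B t y)) = C ((A ^ j) (flow A t x)) := by
    intro j
    induction j with
    | zero => simpa using h
    | succ j ih =>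
      intro t ht
      have h1 : HasDerivWithinAt (fun t => D ((B ^ j) (flow B t y))) (D ((B ^ j) (B (flow B t y))))
          (Set.Ici 0) t :=
        ((D ∘L B ^ j).hasFDerivAt.comp_hasDerivAt t (hasDerivAt_flow_apply B y t)).hasDerivWithinAt
      have h2 : HasDerivWithinAt (fun t => C ((A ^ j) (flow A t x))) (C ((A ^ j) (A (flow A t x))))
          (Set.Ici 0) t :=
        ((C ∘L A ^ j).hasFDerivAt.comp_hasDerivAt t (hasDerivAt_flow_apply A x t)).hasDerivWithinAt
      rw [pow_succ, pow_succ]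
      exact (uniqueDiffOn_Ici 0 t ht).eq_deriv _ h1 (h2.congr (fun s hs => ih s hs) (ih t ht))
  funext j
  simpa [obsMap_apply] using key j 0 le_rfl

theorem FlowConj.range_obsMap_eq {A : V →L[ℝ] V} {C : V →L[ℝ] Y} {B : W →L[ℝ] W}
    {D : W →L[ℝ] Y} (h : FlowConj A C B D) :
    LinearMap.range (obsMap A C) = LinearMap.range (obsMap B D) := by
  obtain ⟨H, h1, h2⟩ := h
  have key : ∀ x, obsMap B D (H x) = obsMap A C x := fun x =>
    obsMap_eq_of_output_eq fun t _ => by rw [← h1, h2]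
  ext z
  constructor
  · rintro ⟨x, rfl⟩
    exact ⟨H x, key x⟩
  · rintro ⟨y, rfl⟩
    exact ⟨H.symm y, by rw [← key, H.apply_symm_apply]⟩

theorem range_obsMap_coprod_zero (A : V →L[ℝ] V) (C : V →L[ℝ] Y) (B : W →L[ℝ] W) :
    LinearMap.range (obsMap (A.prodMap B) (C.coprod (0 : W →L[ℝ] Y))) =
      LinearMap.range (obsMap A C) := by
  have key : ∀ q : V × W, obsMap A C q.1 = obsMap (A.prodMap B) (C.coprod (0 : W →L[ℝ] Y)) q :=
    obsMap_intertwine (ContinuousLinearMap.fst ℝ V W) (fun _ => rfl) (fun q => by simp)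
  ext z
  constructor
  · rintro ⟨q, rfl⟩
    exact ⟨q.1, key q⟩
  · rintro ⟨x, rfl⟩
    exact ⟨(x, 0), (key (x, 0)).symm⟩

/-- An expanding observed system is topologically conjugate to the sum of its observable quotient
and an unobserved system with the field `1`. -/
theorem Expanding.exists_flowConj [FiniteDimensional ℝ V] {A : V →L[ℝ] V} (hA : Expanding A)
    (C : V →L[ℝ] Y) {m k : ℕ} (hk : Module.finrank ℝ (LinearMap.range (obsMap A C)) = k)
    (hm : Module.finrank ℝ (LinearMap.ker (obsMap A C)) = m) :
    ∃ (B : (Fin k → ℝ) →L[ℝ] (Fin k → ℝ)) (D : (Fin k → ℝ) →L[ℝ] Y),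
      Function.Injective (obsMap B D) ∧
      (∀ P : Polynomial ℝ, Polynomial.aeval A P = 0 → Polynomial.aeval B P = 0) ∧
      FlowConj A C (B.prodMap (1 : (Fin m → ℝ) →L[ℝ] (Fin m → ℝ))) (D.coprod 0) := by
  let e : LinearMap.range (obsMap A C) ≃ₗ[ℝ] (Fin k → ℝ) :=
    LinearEquiv.ofFinrankEq _ _ (by simpa using hk)
  let e' : LinearMap.ker (obsMap A C) ≃ₗ[ℝ] (Fin m → ℝ) :=
    LinearEquiv.ofFinrankEq _ _ (by simpa using hm)
  let π : V →L[ℝ] (Fin k → ℝ) :=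
    LinearMap.toContinuousLinearMap (e.toLinearMap ∘ₗ (obsMap A C).rangeRestrict)
  have hπ0 : ∀ x, π x = 0 ↔ obsMap A C x = 0 := by
    intro x
    change e ((obsMap A C).rangeRestrict x) = 0 ↔ _
    rw [LinearEquiv.map_eq_zero_iff, ← Subtype.coe_inj]
    rfl
  have hπs : Function.Surjective π := e.surjective.comp (obsMap A C).surjective_rangeRestrict
  obtain ⟨s', hs'⟩ := LinearMap.exists_rightInverse_of_surjective (π : V →ₗ[ℝ] (Fin k → ℝ))
    (LinearMap.range_eq_top.2 hπs)
  let s : (Fin k → ℝ) →L[ℝ] V := LinearMap.toContinuousLinearMap s'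
  have hs : ∀ w, π (s w) = w := fun w => LinearMap.congr_fun hs' w
  let j' : (Fin m → ℝ) →ₗ[ℝ] V := (LinearMap.ker (obsMap A C)).subtype ∘ₗ e'.symm.toLinearMap
  let j : (Fin m → ℝ) →L[ℝ] V := LinearMap.toContinuousLinearMap j'
  have hj' : Function.Injective j' := Subtype.val_injective.comp e'.symm.injective
  obtain ⟨q', hq'⟩ := LinearMap.exists_leftInverse_of_injective j' (LinearMap.ker_eq_bot.2 hj')
  let q : V →L[ℝ] (Fin m → ℝ) := LinearMap.toContinuousLinearMap q'
  have hqj : ∀ u, q (j u) = u := fun u => LinearMap.congr_fun hq' u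
  have hjπ : ∀ u, π (j u) = 0 := fun u => (hπ0 _).2 (e'.symm u).2
  have hjq : ∀ x, π x = 0 → j (q x) = x := by
    intro x hx
    obtain ⟨u, rfl⟩ : ∃ u, j u = x := by
      refine ⟨e' ⟨x, (hπ0 x).1 hx⟩, ?_⟩
      change ((e'.symm (e' _) : LinearMap.ker (obsMap A C)) : V) = x
      rw [e'.symm_apply_apply]
    rw [hqj]
  have hker : ∀ x, π x = 0 → π (A x) = 0 := by
    intro x hx
    rw [hπ0] at hx ⊢
    funext i
    rw [obsMap_apply_field, hx]
    rfl
  have hkerC : ∀ x, π x = 0 → C x = 0 := fun x hx => congrFun ((hπ0 x).1 hx) 0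
  have hsub : ∀ x, π (x - s (π x)) = 0 := fun x => by rw [map_sub, hs, sub_self]
  -- B and D are the field and output induced on the observable quotient; E is the restriction of A
  -- to the unobservable subspace. The linear section s need not be equivariant.
  let B := π ∘L A ∘L s
  let D := C ∘L s
  let E := q ∘L A ∘L j
  have hπA : ∀ x, π (A x) = B (π x) := by
    intro x
    have := hker _ (hsub x)
    rw [map_sub, map_sub, sub_eq_zero] at this
    exact this
  have hD : ∀ x, D (π x) = C x := by
    intro x
    have := hkerC _ (hsub x)
    rw [map_sub, sub_eq_zero] at this
    exact this.symm
  have hjE : ∀ u, j (E u) = A (j u) := fun u => hjq _ (hker _ (hjπ u))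
  have hB : Expanding B := hA.of_surjective π s hs hπA
  have hE : Expanding E := hA.of_injective j q hqj hjE
  obtain ⟨g, hg⟩ := hE.exists_homeomorph
  obtain ⟨Φ, hΦc, hΦπ, hΦ⟩ := hA.exists_section hB π s hs hπA
  have hzero : ∀ x, π (x - Φ (π x)) = 0 := fun x => by rw [map_sub, hΦπ, sub_self]
  refine ⟨B, D, ?_, ?_, ?_⟩
  · refine (injective_iff_map_eq_zero _).2 fun w hw => ?_
    rw [← hs w, obsMap_intertwine π hπA hD, ← hπ0, hs] at hw
    exact hw
  · intro P hP
    ext w : 1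
    have := aeval_intertwine π hπA P (s w)
    rw [hP, hs] at this
    simpa using this.symm
  · refine ⟨{ toFun := fun x => (π x, g (q (x - Φ (π x))))
              invFun := fun z => Φ z.1 + j (g.symm z.2)
              left_inv := fun x => ?_
              right_inv := fun z => ?_
              continuous_toFun := ?_
              continuous_invFun := ?_ }, fun t x => ?_, fun x => ?_⟩
    · simp only [Homeomorph.symm_apply_apply]
      rw [hjq _ (hzero x)]
      abel
    · have h1 : π (Φ z.1 + j (g.symm z.2)) = z.1 := by rw [map_add, hΦπ, hjπ, add_zero]
      simp only [h1, add_sub_cancel_left, hqj, Homeomorph.apply_symm_apply]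
    · exact π.continuous.prodMk (g.continuous.comp (q.continuous.comp
        (continuous_id.sub (hΦc.comp π.continuous))))
    · exact (hΦc.comp continuous_fst).add (j.continuous.comp (g.symm.continuous.comp continuous_snd))
    · rw [flow_prodMap]
      refine Prod.ext (flow_intertwine π hπA t x) ?_
      change g (q (flow A t x - Φ (π (flow A t x)))) = flow 1 t (g (q (x - Φ (π x))))
      -- Equivariance of Φ and linearity of the flow move x − Φ(π x) along the flow of A; this
      -- vector lies in the range of j, where that flow is the flow of E.
      rw [flow_intertwine π hπA, hΦ, ← map_sub, ← hg]
      congr 1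
      conv_lhs => rw [← hjq _ (hzero x), ← flow_intertwine j hjE, hqj]
    · simpa using hD x

end FlowConj

/-! ### Factoring by the real parts of the roots -/

section RealPolynomials

open Polynomial

/-- The complex roots of an irreducible real polynomial have the same real part. -/
theorem Irreducible.exists_re_eq {q : ℝ[X]} (hq : Irreducible q) :
    ∃ c : ℝ, ∀ z : ℂ, aeval z q = 0 → z.re = c := by
  obtain ⟨z, hz⟩ : ∃ z : ℂ, aeval z q = 0 :=
    IsAlgClosed.exists_aeval_eq_zero ℂ q (Polynomial.degree_pos_of_irreducible hq).ne'
  refine ⟨z.re, fun w hw => ?_⟩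
  have hint : IsIntegral ℝ z := Algebra.IsIntegral.isIntegral z
  -- Any root w of q is thus a root of the minimal polynomial of z, which divides (X − Re z)² + (Im
  -- z)². Comparing real and imaginary parts at w forces Re w = Re z.
  have hdvd : q ∣ minpoly ℝ z :=
    ((minpoly.irreducible hint).associated_of_dvd hq (minpoly.dvd ℝ z hz)).symm.dvd
  have hw' : aeval w (minpoly ℝ z) = 0 := by
    obtain ⟨r, hr⟩ := hdvd
    rw [hr, map_mul, hw, zero_mul]
  have hr : aeval z ((X - C z.re) ^ 2 + C (z.im ^ 2)) = 0 := by
    have : (z - z.re) = z.im * Complex.I := by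
      apply Complex.ext <;> simp
    simp only [map_add, map_pow, map_sub, aeval_X, aeval_C, Complex.coe_algebraMap]
    rw [this, mul_pow, Complex.I_sq]
    ring
  obtain ⟨r, hr'⟩ := minpoly.dvd ℝ z hr
  have h0 : aeval w ((X - C z.re) ^ 2 + C (z.im ^ 2)) = 0 := by rw [hr', map_mul, hw', zero_mul]
  simp only [map_add, map_pow, map_sub, aeval_X, aeval_C, Complex.coe_algebraMap] at h0
  have hre := congrArg Complex.re h0
  have him := congrArg Complex.im h0
  simp only [pow_two, Complex.add_re, Complex.mul_re, Complex.sub_re, Complex.ofReal_re,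
    Complex.sub_im, Complex.ofReal_im, Complex.add_im, Complex.mul_im, sub_zero, Complex.zero_re,
    Complex.zero_im, mul_zero, zero_mul, add_zero] at hre him
  by_cases hi : w.im = 0
  · rw [hi] at hre
    nlinarith [sq_nonneg (w.re - z.re), sq_nonneg z.im]
  · have : (w.re - z.re) * w.im = 0 := by linarith
    rcases mul_eq_zero.1 this with h | h
    · linarith
    · exact absurd h hi

/-- A real polynomial is the product of polynomials whose roots have zero, positive and negative
real parts. -/
theorem Polynomial.exists_eq_mul_of_re_sign (f : ℝ[X]) (hf : f ≠ 0) :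
    ∃ f₀ f₁ f₂ : ℝ[X], f = f₀ * (f₁ * f₂) ∧ (∀ z : ℂ, aeval z f₀ = 0 → z.re = 0) ∧
      (∀ z : ℂ, aeval z f₁ = 0 → 0 < z.re) ∧ ∀ z : ℂ, aeval z f₂ = 0 → z.re < 0 := by
  induction f using WfDvdMonoid.induction_on_irreducible with
  | zero => exact absurd rfl hf
  | unit u hu =>
    refine ⟨u, 1, 1, by simp, fun z hz => ?_, fun z hz => ?_, fun z hz => ?_⟩
    · exact absurd hz (hu.map (aeval z : ℝ[X] →ₐ[ℝ] ℂ)).ne_zero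
    · simp at hz
    · simp at hz
  | mul a i ha hi ih =>
    obtain ⟨f₀, f₁, f₂, h, h0, h1, h2⟩ := ih ha
    obtain ⟨c, hc⟩ := hi.exists_re_eq
    rcases lt_trichotomy c 0 with hc0 | hc0 | hc0
    · refine ⟨f₀, f₁, i * f₂, by rw [h]; ring, h0, h1, fun z hz => ?_⟩
      rw [map_mul] at hz
      rcases mul_eq_zero.1 hz with hz | hz
      · rw [hc z hz]; exact hc0
      · exact h2 z hz
    · refine ⟨i * f₀, f₁, f₂, by rw [h]; ring, fun z hz => ?_, h1, h2⟩
      rw [map_mul] at hz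
      rcases mul_eq_zero.1 hz with hz | hz
      · rw [hc z hz]; exact hc0
      · exact h0 z hz
    · refine ⟨f₀, i * f₁, f₂, by rw [h]; ring, h0, fun z hz => ?_, h2⟩
      rw [map_mul] at hz
      rcases mul_eq_zero.1 hz with hz | hz
      · rw [hc z hz]; exact hc0
      · exact h1 z hz

theorem Polynomial.isCoprime_of_re {f g : ℝ[X]} {P Q : ℝ → Prop} (hPQ : ∀ r, P r → ¬ Q r)
    (hf : ∀ z : ℂ, aeval z f = 0 → P z.re) (hg : ∀ z : ℂ, aeval z g = 0 → Q z.re) :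
    IsCoprime f g := by
  rw [isCoprime_iff_aeval_ne_zero_of_isAlgClosed ℝ ℂ]
  intro z
  by_contra! h
  exact hPQ _ (hf z h.1) (hg z h.2)

end RealPolynomials

/-! ### Annihilating polynomials and block decomposition -/

section MatrixPolynomials

open Polynomial

variable {ι : Type*} [Fintype ι] [DecidableEq ι]

/-- Spectral mapping: f(μ) lies in the spectrum of f(A) = 0, where a nonzero scalar cannot lie. -/
theorem aeval_of_mem_spectrum_map {A : Matrix ι ι ℝ} {f : ℝ[X]} (hf : aeval A f = 0) {μ : ℂ}
    (hμ : μ ∈ spectrum ℂ (A.map (algebraMap ℝ ℂ))) : aeval μ f = 0 := by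
  have h1 : aeval (A.map (algebraMap ℝ ℂ)) (f.map (algebraMap ℝ ℂ)) = 0 := by
    rw [aeval_map_algebraMap]
    have := aeval_algHom_apply ((Algebra.ofId ℝ ℂ).mapMatrix : Matrix ι ι ℝ →ₐ[ℝ] Matrix ι ι ℂ) A f
    rw [hf, map_zero] at this
    exact this
  have h2 := spectrum.subset_polynomial_aeval (A.map (algebraMap ℝ ℂ)) (f.map (algebraMap ℝ ℂ))
    ⟨μ, hμ, rfl⟩
  rw [h1] at h2
  by_contra hne
  apply h2
  rw [spectrum.mem_resolventSet_iff, sub_zero]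
  refine (IsUnit.mk0 _ ?_).map (algebraMap ℂ (Matrix ι ι ℂ))
  change eval μ (f.map (algebraMap ℝ ℂ)) ≠ 0
  rwa [eval_map_algebraMap]

theorem mem_spectrum_map_of_aeval_charpoly {A : Matrix ι ι ℝ} {z : ℂ}
    (hz : aeval z A.charpoly = 0) : z ∈ spectrum ℂ (A.map (algebraMap ℝ ℂ)) := by
  rw [Matrix.mem_spectrum_iff_isRoot_charpoly, Matrix.charpoly_map, IsRoot, eval_map_algebraMap]
  exact hz

theorem matrixCLM_pow_apply (A : Matrix ι ι ℝ) (n : ℕ) (x : ι → ℝ) :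
    (matrixCLM A ^ n) x = (A ^ n).mulVec x := by
  induction n generalizing x with
  | zero => simp
  | succ n ih => rw [pow_succ, pow_succ, mul_apply_eq_comp, ih, matrixCLM_apply, Matrix.mulVec_mulVec]

theorem aeval_matrixCLM_apply (A : Matrix ι ι ℝ) (f : ℝ[X]) (x : ι → ℝ) :
    aeval (matrixCLM A) f x = (aeval A f).mulVec x := by
  induction f using Polynomial.induction_on' with
  | add P Q hP hQ => rw [map_add, map_add, add_apply, hP, hQ, Matrix.add_mulVec]
  | monomial n a =>
    simp only [aeval_monomial, Algebra.algebraMap_eq_smul_one, smul_mul_assoc, one_mul, smul_apply,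
      matrixCLM_pow_apply, Matrix.smul_mulVec]

theorem aeval_matrixCLM_charpoly (A : Matrix ι ι ℝ) : aeval (matrixCLM A) A.charpoly = 0 := by
  refine ContinuousLinearMap.ext fun x => ?_
  rw [aeval_matrixCLM_apply, Matrix.aeval_self_charpoly]
  simp

theorem aeval_eq_zero_of_aeval_matrixCLM {A : Matrix ι ι ℝ} {f : ℝ[X]}
    (h : aeval (matrixCLM A) f = 0) : aeval A f = 0 := by
  refine Matrix.toLin'.injective (LinearMap.ext fun x => ?_)
  rw [Matrix.toLin'_apply, ← aeval_matrixCLM_apply, h]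
  simp

/-- Every continuous linear map between coordinate spaces is given by a matrix. -/
theorem exists_matrixCLM_eq {κ : Type*} [Fintype κ] (L : (ι → ℝ) →L[ℝ] (κ → ℝ)) :
    ∃ A : Matrix κ ι ℝ, matrixCLM A = L :=
  ⟨LinearMap.toMatrix' (L : (ι → ℝ) →ₗ[ℝ] (κ → ℝ)), ContinuousLinearMap.ext fun x => by
    rw [matrixCLM_apply, LinearMap.toMatrix'_mulVec]; rfl⟩

/-- The decomposition of a linear map along a coprime factorization of an annihilating
polynomial. -/
theorem exists_blockDiagonal {V : Type*} [NormedAddCommGroup V] [NormedSpace ℝ V]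
    [FiniteDimensional ℝ V] (L : V →L[ℝ] V) {f g : ℝ[X]} (hfg : IsCoprime f g)
    (h : aeval L (f * g) = 0) :
    ∃ (a b : ℕ) (A : Matrix (Fin a) (Fin a) ℝ) (B : Matrix (Fin b) (Fin b) ℝ)
      (M : V ≃ₗ[ℝ] (Fin a → ℝ) × (Fin b → ℝ)),
      aeval (matrixCLM A) f = 0 ∧ aeval (matrixCLM B) g = 0 ∧
        ∀ x, M (L x) = (matrixCLM A).prodMap (matrixCLM B) (M x) := by
  have hcomm : ∀ (P : ℝ[X]) x, aeval L P (L x) = L (aeval L P x) := fun P x =>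
    (aeval_intertwine L (fun _ => rfl) P x).symm
  have hmul : ∀ (P Q : ℝ[X]) x, aeval L (P * Q) x = aeval L P (aeval L Q x) := fun P Q x => by
    rw [map_mul, mul_apply_eq_comp]
  have hinv : ∀ P : ℝ[X], ∀ x ∈ LinearMap.ker (aeval L P : V →ₗ[ℝ] V),
      (L : V →ₗ[ℝ] V) x ∈ LinearMap.ker (aeval L P : V →ₗ[ℝ] V) := by
    intro P x hx
    change aeval L P (L x) = 0
    rw [hcomm, show aeval L P x = 0 from hx, map_zero]
  -- Bézout's identity splits each x; the term containing g(L) is killed by f(L), and conversely.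
  have hcompl : IsCompl (LinearMap.ker (aeval L f : V →ₗ[ℝ] V))
      (LinearMap.ker (aeval L g : V →ₗ[ℝ] V)) := by
    obtain ⟨a, b, hab⟩ := hfg
    have hx : ∀ x, x = aeval L a (aeval L f x) + aeval L b (aeval L g x) := by
      intro x
      have := congrArg (fun P => aeval L P x) hab
      simp only [map_add, add_apply, map_one, one_apply_eq_self, hmul] at this
      exact this.symm
    refine IsCompl.of_eq (Submodule.eq_bot_iff _ |>.2 fun x hx' => ?_)
      (Submodule.eq_top_iff'.2 fun x => ?_)
    · rw [hx x, show aeval L f x = 0 from hx'.1, show aeval L g x = 0 from hx'.2]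
      simp
    · rw [hx x, add_comm]
      refine Submodule.add_mem_sup ?_ ?_
      · change aeval L f (aeval L b (aeval L g x)) = 0
        rw [← hmul, ← hmul, show f * b * g = b * (f * g) by ring, map_mul, h]
        simp
      · change aeval L g (aeval L a (aeval L f x)) = 0
        rw [← hmul, ← hmul, show g * a * f = a * (f * g) by ring, map_mul, h]
        simp
  have piece : ∀ P : ℝ[X], ∃ (a : ℕ) (A : Matrix (Fin a) (Fin a) ℝ)
      (e : LinearMap.ker (aeval L P : V →ₗ[ℝ] V) ≃ₗ[ℝ] (Fin a → ℝ)),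
      aeval (matrixCLM A) P = 0 ∧ ∀ u, (e.symm (matrixCLM A u) : V) = L (e.symm u) := by
    intro P
    let e := (Module.finBasis ℝ (LinearMap.ker (aeval L P : V →ₗ[ℝ] V))).equivFun
    obtain ⟨A, hA⟩ := exists_matrixCLM_eq (LinearMap.toContinuousLinearMap
      (e.toLinearMap ∘ₗ (L : V →ₗ[ℝ] V).restrict (hinv P) ∘ₗ e.symm.toLinearMap))
    have hAu : ∀ u, (e.symm (matrixCLM A u) : V) = L (e.symm u) := by
      intro u
      rw [hA]
      change ((e.symm (e ((L : V →ₗ[ℝ] V).restrict (hinv P) (e.symm u))) :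
        LinearMap.ker (aeval L P : V →ₗ[ℝ] V)) : V) = _
      rw [e.symm_apply_apply]
      rfl
    refine ⟨_, A, e, ContinuousLinearMap.ext fun u => ?_, hAu⟩
    have := aeval_intertwine (LinearMap.toContinuousLinearMap
      ((LinearMap.ker (aeval L P : V →ₗ[ℝ] V)).subtype ∘ₗ e.symm.toLinearMap)) hAu P u
    have h0 : aeval L P (e.symm u : V) = 0 := (e.symm u).2
    have h1 : ((e.symm (aeval (matrixCLM A) P u) : LinearMap.ker (aeval L P : V →ₗ[ℝ] V)) : V) = 0 :=
      this.trans h0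
    simpa using h1
  obtain ⟨a, A, e, hA, hAL⟩ := piece f
  obtain ⟨b, B, e', hB, hBL⟩ := piece g
  let N : ((Fin a → ℝ) × (Fin b → ℝ)) ≃ₗ[ℝ] V :=
    (e.symm.prodCongr e'.symm).trans (Submodule.prodEquivOfIsCompl _ _ hcompl)
  have hN : ∀ u, N u = (e.symm u.1 : V) + (e'.symm u.2 : V) := fun u => by
    simp [N, Submodule.coe_prodEquivOfIsCompl']
  refine ⟨a, b, A, B, N.symm, hA, hB, fun x => ?_⟩
  rw [LinearEquiv.symm_apply_eq, hN]
  conv_lhs => rw [← N.apply_symm_apply x, hN, map_add, ← hAL, ← hBL]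
  rfl

end MatrixPolynomials

/-! ### Systems in terms of flows, Kalman rank, spectral splitting -/

namespace ObservedSystem

variable {ι κ : Type*} [Fintype ι] [Fintype κ] [DecidableEq ι] [DecidableEq κ] {p : ℕ}

/-- The state field of `S` as a continuous linear map. -/
noncomputable abbrev field (S : ObservedSystem ι p) : (ι → ℝ) →L[ℝ] (ι → ℝ) := matrixCLM S.A

/-- The observation of `S` as a continuous linear map. -/
noncomputable abbrev output (S : ObservedSystem ι p) : (ι → ℝ) →L[ℝ] (Fin p → ℝ) := matrixCLM S.C

theorem isSolution_flow (S : ObservedSystem ι p) (x : ι → ℝ) :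
    S.IsSolution fun t => flow S.field t x :=
  fun t _ => (hasDerivAt_flow_apply S.field x t).hasDerivWithinAt

theorem IsSolution.eq_flow {S : ObservedSystem ι p} {x : ℝ → ι → ℝ} (h : S.IsSolution x) {t : ℝ}
    (ht : 0 ≤ t) : x t = flow S.field t (x 0) :=
  eq_flow_of_hasDerivWithinAt S.field h ht

theorem brings_iff {S₁ : ObservedSystem ι p} {S₂ : ObservedSystem κ p}
    {h : (ι → ℝ) → (κ → ℝ)} :
    S₁.Brings S₂ h ↔ (∀ t, 0 ≤ t → ∀ x, h (flow S₁.field t x) = flow S₂.field t (h x)) ∧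
      ∀ x, S₂.output (h x) = S₁.output x := by
  constructor
  · intro hb
    refine ⟨fun t ht x => ?_, fun x => ?_⟩
    · simpa using (hb _ (S₁.isSolution_flow x)).1.eq_flow ht
    · simpa using (hb _ (S₁.isSolution_flow x)).2 0 le_rfl
  · rintro ⟨h1, h2⟩ x hx
    refine ⟨fun t ht => ?_, fun t _ => h2 (x t)⟩
    have key : ∀ s, 0 ≤ s → h (x s) = flow S₂.field s (h (x 0)) := fun s hs => by
      rw [hx.eq_flow hs, h1 s hs]
    have := S₂.isSolution_flow (h (x 0)) t ht
    simp only [← key t ht] at this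
    exact this.congr (fun s hs => key s hs) (key t ht)

/-- Equivalence only concerns t ≥ 0; invertibility of the flows extends the conjugacy to negative
times. -/
theorem topologicallyEquivalent_iff {S₁ : ObservedSystem ι p} {S₂ : ObservedSystem κ p} :
    S₁.TopologicallyEquivalent S₂ ↔ Fintype.card ι = Fintype.card κ ∧
      FlowConj S₁.field S₁.output S₂.field S₂.output := by
  refine and_congr_right fun _ => ⟨?_, ?_⟩
  · rintro ⟨H, h1, -⟩
    obtain ⟨h1, h2⟩ := brings_iff.1 h1
    refine ⟨H, fun t x => ?_, h2⟩
    rcases le_total 0 t with ht | ht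
    · exact h1 t ht x
    · have := h1 (-t) (by linarith) (flow S₁.field t x)
      rw [flow_neg_apply_flow] at this
      rw [this, flow_apply_flow_neg]
  · rintro ⟨H, h1, h2⟩
    refine ⟨H, brings_iff.2 ⟨fun t _ x => h1 t x, h2⟩, brings_iff.2 ⟨fun t _ x => ?_, fun x => ?_⟩⟩
    · rw [H.symm_apply_eq, h1, H.apply_symm_apply]
    · rw [← h2, H.apply_symm_apply]

/-- For a linear map, differentiating the conjugacy at t = 0 recovers the intertwining of the
fields. -/
theorem brings_linearMap_iff {S₁ : ObservedSystem ι p} {S₂ : ObservedSystem κ p}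
    {M : (ι → ℝ) →ₗ[ℝ] (κ → ℝ)} :
    S₁.Brings S₂ M ↔ (∀ x, M (S₁.field x) = S₂.field (M x)) ∧
      ∀ x, S₂.output (M x) = S₁.output x := by
  rw [brings_iff]
  refine and_congr_left fun _ => ⟨fun h x => ?_, fun h t _ x => ?_⟩
  · have h1 := (M.toContinuousLinearMap.hasFDerivAt.comp_hasDerivAt (0 : ℝ)
      (hasDerivAt_flow_apply S₁.field x 0)).hasDerivWithinAt (s := Set.Ici 0)
    have h2 := (hasDerivAt_flow_apply S₂.field (M x) 0).hasDerivWithinAt (s := Set.Ici 0)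
    have h3 := (uniqueDiffOn_Ici (0 : ℝ) 0 Set.self_mem_Ici).eq_deriv _ h1
      (h2.congr (fun t ht => h t ht x) (h 0 le_rfl x))
    simpa using h3
  · exact flow_intertwine M.toContinuousLinearMap h t x

theorem linearlyEquivalent_iff {S₁ : ObservedSystem ι p} {S₂ : ObservedSystem κ p} :
    S₁.LinearlyEquivalent S₂ ↔ ∃ M : (ι → ℝ) ≃ₗ[ℝ] (κ → ℝ),
      (∀ x, M (S₁.field x) = S₂.field (M x)) ∧ ∀ x, S₂.output (M x) = S₁.output x := by
  constructor
  · rintro ⟨M, h1, -⟩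
    exact ⟨M, brings_linearMap_iff (M := (M : (ι → ℝ) →ₗ[ℝ] (κ → ℝ))).1 h1⟩
  · rintro ⟨M, h1, h2⟩
    refine ⟨M, brings_linearMap_iff (M := (M : (ι → ℝ) →ₗ[ℝ] (κ → ℝ))).2 ⟨h1, h2⟩,
      brings_linearMap_iff (M := (M.symm : (κ → ℝ) →ₗ[ℝ] (ι → ℝ))).2 ⟨fun x => ?_, fun x => ?_⟩⟩
    · change M.symm (S₂.field x) = S₁.field (M.symm x)
      rw [LinearEquiv.symm_apply_eq, h1, M.apply_symm_apply]
    · change S₁.output (M.symm x) = S₂.output x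
      rw [← h2, M.apply_symm_apply]

theorem LinearlyEquivalent.flowConj {S₁ : ObservedSystem ι p} {S₂ : ObservedSystem κ p}
    (h : S₁.LinearlyEquivalent S₂) : FlowConj S₁.field S₁.output S₂.field S₂.output := by
  obtain ⟨M, h1, h2⟩ := linearlyEquivalent_iff.1 h
  exact FlowConj.of_linearEquiv M h1 h2

theorem linearlyEquivalent_of_range_eq {S₁ : ObservedSystem ι p} {S₂ : ObservedSystem κ p}
    (h₁ : Function.Injective (obsMap S₁.field S₁.output))
    (h₂ : Function.Injective (obsMap S₂.field S₂.output))
    (h : LinearMap.range (obsMap S₁.field S₁.output) =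
      LinearMap.range (obsMap S₂.field S₂.output)) : S₁.LinearlyEquivalent S₂ :=
  linearlyEquivalent_iff.2 (exists_linearEquiv_of_range_obsMap_eq h₁ h₂ h)

/-- The states of a block sum as pairs of states. -/
noncomputable def sumEquiv (ι κ : Type*) : (ι ⊕ κ → ℝ) ≃ₗ[ℝ] (ι → ℝ) × (κ → ℝ) :=
  LinearEquiv.sumArrowLequivProdArrow ι κ ℝ ℝ

theorem sumEquiv_field (S₁ : ObservedSystem ι p) (S₂ : ObservedSystem κ p) (x : ι ⊕ κ → ℝ) :
    sumEquiv ι κ ((S₁.blockSum S₂).field x) = S₁.field.prodMap S₂.field (sumEquiv ι κ x) := by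
  simp only [matrixCLM_apply, blockSum, Matrix.fromBlocks_mulVec]
  refine Prod.ext ?_ ?_ <;> funext i <;> simp [sumEquiv] <;> rfl

theorem sumEquiv_output (S₁ : ObservedSystem ι p) (S₂ : ObservedSystem κ p) (x : ι ⊕ κ → ℝ) :
    S₁.output.coprod S₂.output (sumEquiv ι κ x) = (S₁.blockSum S₂).output x := by
  simp only [matrixCLM_apply, blockSum, Matrix.fromCols_mulVec, ContinuousLinearMap.coprod_apply]
  rfl

theorem flowConj_blockSum (S₁ : ObservedSystem ι p) (S₂ : ObservedSystem κ p) :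
    FlowConj (S₁.blockSum S₂).field (S₁.blockSum S₂).output (S₁.field.prodMap S₂.field)
      (S₁.output.coprod S₂.output) :=
  FlowConj.of_linearEquiv (sumEquiv ι κ) (sumEquiv_field S₁ S₂) (sumEquiv_output S₁ S₂)

theorem flowConj_signSystem (a b p : ℕ) :
    FlowConj (signSystem a b p).field (signSystem a b p).output
      ((1 : (Fin a → ℝ) →L[ℝ] (Fin a → ℝ)).prodMap (-1 : (Fin b → ℝ) →L[ℝ] (Fin b → ℝ))) 0 := by
  refine FlowConj.of_linearEquiv (sumEquiv (Fin a) (Fin b)) (fun x => ?_) fun x => ?_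
  · simp only [matrixCLM_apply, signSystem, Matrix.fromBlocks_mulVec]
    refine Prod.ext ?_ ?_ <;> funext i <;> simp [sumEquiv, Matrix.neg_mulVec]
  · simp [signSystem]

/-- Cayley–Hamilton: every power of A is a combination of powers below n. The case n = 0 is separate
because the remainder then has no degree below n. -/
theorem obsMatrix_mulVec_eq_zero_iff {n : ℕ} (S : ObservedSystem (Fin n) p) (x : Fin n → ℝ) :
    S.obsMatrix.mulVec x = 0 ↔ obsMap S.field S.output x = 0 := by
  have hentry : ∀ (j : ℕ) (i : Fin p),
      obsMap S.field S.output x j i = ((S.C * S.A ^ j).mulVec x) i := by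
    intro j i
    rw [obsMap_apply, matrixCLM_pow_apply, matrixCLM_apply, Matrix.mulVec_mulVec]
  have hrow : ∀ (j : Fin n) (i : Fin p),
      S.obsMatrix.mulVec x (j, i) = obsMap S.field S.output x j i := by
    intro j i
    rw [hentry]
    rfl
  constructor
  · intro h
    rcases Nat.eq_zero_or_pos n with rfl | hn
    · rw [Subsingleton.elim x 0, map_zero]
    funext j
    have hlt : (Polynomial.X ^ j %ₘ S.A.charpoly).natDegree < n := by
      have := Polynomial.natDegree_modByMonic_lt (Polynomial.X ^ j) S.A.charpoly_monic (by
        intro h1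
        have := S.A.charpoly_natDegree_eq_dim
        rw [h1] at this
        simp at this
        omega)
      simpa using this
    rw [obsMap_apply, matrixCLM_pow_apply, Matrix.pow_eq_aeval_mod_charpoly,
      ← aeval_matrixCLM_apply, Polynomial.aeval_eq_sum_range' hlt, sum_apply, map_sum]
    refine Finset.sum_eq_zero fun i hi => ?_
    rw [smul_apply, map_smul, ← obsMap_apply]
    have : obsMap S.field S.output x i = 0 := by
      funext l
      rw [← hrow ⟨i, Finset.mem_range.1 hi⟩ l, h]
      rfl
    rw [this, smul_zero]
  · intro h
    funext ⟨j, i⟩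
    rw [hrow, h]
    rfl

theorem ker_obsMatrix {n : ℕ} (S : ObservedSystem (Fin n) p) :
    LinearMap.ker S.obsMatrix.mulVecLin = LinearMap.ker (obsMap S.field S.output) := by
  ext x
  exact S.obsMatrix_mulVec_eq_zero_iff x

theorem kObs_add_finrank_ker {n : ℕ} (S : ObservedSystem (Fin n) p) :
    S.kObs + Module.finrank ℝ (LinearMap.ker (obsMap S.field S.output)) = n := by
  have := LinearMap.finrank_range_add_finrank_ker S.obsMatrix.mulVecLin
  rw [ker_obsMatrix, Module.finrank_fin_fun] at this
  exact this

theorem finrank_range_obsMap {n : ℕ} (S : ObservedSystem (Fin n) p) :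
    Module.finrank ℝ (LinearMap.range (obsMap S.field S.output)) = S.kObs := by
  have h1 := LinearMap.finrank_range_add_finrank_ker (obsMap S.field S.output)
  have h2 := S.kObs_add_finrank_ker
  simp only [Module.finrank_fin_fun] at h1
  omega

theorem completelyObservable_iff {n : ℕ} (S : ObservedSystem (Fin n) p) :
    S.CompletelyObservable ↔ Function.Injective (obsMap S.field S.output) := by
  rw [← LinearMap.ker_eq_bot, ← Submodule.finrank_eq_zero, CompletelyObservable]
  have := S.kObs_add_finrank_ker
  omega

/-- A real matrix can be brought to block form according to the sign of the real parts of its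
eigenvalues. -/
theorem nonempty_spectralDecomposition {n : ℕ} (S : ObservedSystem (Fin n) p) :
    Nonempty (SpectralDecomposition S) := by
  obtain ⟨f₀, f₁, f₂, hf, h₀, h₁, h₂⟩ :=
    Polynomial.exists_eq_mul_of_re_sign S.A.charpoly S.A.charpoly_monic.ne_zero
  have h12 : ∀ z : ℂ, Polynomial.aeval z (f₁ * f₂) = 0 → z.re ≠ 0 := by
    intro z hz
    rw [map_mul] at hz
    rcases mul_eq_zero.1 hz with hz | hz
    · exact (h₁ z hz).ne'
    · exact (h₂ z hz).ne
  have hc : IsCoprime f₀ (f₁ * f₂) :=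
    Polynomial.isCoprime_of_re (fun r (hr : r = 0) (hr' : r ≠ 0) => hr' hr) h₀ h12
  have hc' : IsCoprime f₁ f₂ :=
    Polynomial.isCoprime_of_re (fun r (hr : 0 < r) (hr' : r < 0) => lt_asymm hr hr') h₁ h₂
  have hS : Polynomial.aeval S.field (f₀ * (f₁ * f₂)) = 0 := by
    rw [← hf]
    exact aeval_matrixCLM_charpoly S.A
  obtain ⟨a, b, A, B, M, hA, hB, hM⟩ := exists_blockDiagonal S.field hc hS
  obtain ⟨c, d, A', B', M', hA', hB', hM'⟩ := exists_blockDiagonal (matrixCLM B) hc' hB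
  let N : (Fin n → ℝ) ≃ₗ[ℝ] (Fin a → ℝ) × ((Fin c → ℝ) × (Fin d → ℝ)) :=
    M.trans ((LinearEquiv.refl ℝ (Fin a → ℝ)).prodCongr M')
  have hN : ∀ x, N (S.field x) =
      (matrixCLM A).prodMap ((matrixCLM A').prodMap (matrixCLM B')) (N x) := by
    intro x
    simp only [N, LinearEquiv.trans_apply, hM]
    exact Prod.ext rfl (hM' _)
  let L : (Fin n → ℝ) →L[ℝ] (Fin p → ℝ) := S.output
  obtain ⟨C₀, hC₀⟩ := exists_matrixCLM_eq (L ∘L LinearMap.toContinuousLinearMap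
    (N.symm.toLinearMap ∘ₗ LinearMap.inl ℝ _ _))
  obtain ⟨C₁, hC₁⟩ := exists_matrixCLM_eq (L ∘L LinearMap.toContinuousLinearMap
    (N.symm.toLinearMap ∘ₗ LinearMap.inr ℝ _ _ ∘ₗ LinearMap.inl ℝ _ _))
  obtain ⟨C₂, hC₂⟩ := exists_matrixCLM_eq (L ∘L LinearMap.toContinuousLinearMap
    (N.symm.toLinearMap ∘ₗ LinearMap.inr ℝ _ _ ∘ₗ LinearMap.inr ℝ _ _))
  have hout : ∀ q : (Fin a → ℝ) × ((Fin c → ℝ) × (Fin d → ℝ)),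
      (matrixCLM C₀).coprod ((matrixCLM C₁).coprod (matrixCLM C₂)) q = L (N.symm q) := by
    intro q
    simp only [ContinuousLinearMap.coprod_apply, hC₀, hC₁, hC₂]
    change L (N.symm (q.1, 0)) + (L (N.symm (0, (q.2.1, 0))) + L (N.symm (0, (0, q.2.2)))) = _
    rw [← map_add, ← map_add, ← map_add, ← map_add]
    simp
  let S₀ : ObservedSystem (Fin a) p := ⟨A, C₀⟩
  let S₁ : ObservedSystem (Fin c) p := ⟨A', C₁⟩
  let S₂ : ObservedSystem (Fin d) p := ⟨B', C₂⟩
  let T := (sumEquiv (Fin a) (Fin c ⊕ Fin d)).trans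
    ((LinearEquiv.refl ℝ (Fin a → ℝ)).prodCongr (sumEquiv (Fin c) (Fin d)))
  have hT : ∀ x, T ((S₀.blockSum (S₁.blockSum S₂)).field x) =
      (matrixCLM A).prodMap ((matrixCLM A').prodMap (matrixCLM B')) (T x) := by
    intro x
    simp only [T, LinearEquiv.trans_apply, sumEquiv_field]
    exact Prod.ext rfl (sumEquiv_field S₁ S₂ _)
  have hTout : ∀ x, (matrixCLM C₀).coprod ((matrixCLM C₁).coprod (matrixCLM C₂)) (T x) =
      (S₀.blockSum (S₁.blockSum S₂)).output x := by
    intro x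
    rw [← sumEquiv_output]
    simp only [T, LinearEquiv.trans_apply, ContinuousLinearMap.coprod_apply]
    exact congrArg _ (sumEquiv_output S₁ S₂ (sumEquiv (Fin a) (Fin c ⊕ Fin d) x).2)
  refine ⟨{ nZero := a, nPlus := c, nMinus := d, zero := S₀, plus := S₁, minus := S₂
            linearlyEquivalent := linearlyEquivalent_iff.2 ⟨N.trans T.symm, fun x => ?_, fun x => ?_⟩
            re_zero := fun μ hμ => h₀ μ (aeval_of_mem_spectrum_map
              (aeval_eq_zero_of_aeval_matrixCLM hA) hμ)
            re_plus := fun μ hμ => h₁ μ (aeval_of_mem_spectrum_map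
              (aeval_eq_zero_of_aeval_matrixCLM hA') hμ)
            re_minus := fun μ hμ => h₂ μ (aeval_of_mem_spectrum_map
              (aeval_eq_zero_of_aeval_matrixCLM hB') hμ) }⟩
  · simp only [LinearEquiv.trans_apply]
    rw [LinearEquiv.symm_apply_eq, hT, T.apply_symm_apply, hN]
  · simp only [LinearEquiv.trans_apply]
    rw [← hTout, T.apply_symm_apply, hout, N.symm_apply_apply]

end ObservedSystem

/-! ### Time reversal -/

section TimeReversal

variable {V Y : Type*} [NormedAddCommGroup V] [NormedSpace ℝ V]
  [NormedAddCommGroup Y] [NormedSpace ℝ Y]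

/-- Negating the field changes jets only by signs. -/
theorem ker_obsMap_neg (A : V →L[ℝ] V) (C : V →L[ℝ] Y) :
    LinearMap.ker (obsMap (-A) C) = LinearMap.ker (obsMap A C) := by
  have key : ∀ (A : V →L[ℝ] V) x, obsMap A C x = 0 → obsMap (-A) C x = 0 := by
    intro A x hx
    funext j
    have := congrFun hx j
    rw [obsMap_apply] at this ⊢
    rw [neg_pow, ← Int.cast_one, ← Int.cast_neg, ← Int.cast_pow, ← zsmul_eq_mul, smul_apply,
      map_zsmul, this]
    exact smul_zero _
  ext x
  refine ⟨fun h => ?_, key A x⟩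
  have := key (-A) x h
  rwa [neg_neg] at this

/-- The time-reversed form of `Expanding.exists_flowConj`. -/
theorem Expanding.exists_flowConj_neg [FiniteDimensional ℝ V] {A : V →L[ℝ] V}
    (hA : Expanding (-A)) (C : V →L[ℝ] Y) {m k : ℕ}
    (hk : Module.finrank ℝ (LinearMap.range (obsMap A C)) = k)
    (hm : Module.finrank ℝ (LinearMap.ker (obsMap A C)) = m) :
    ∃ (B : (Fin k → ℝ) →L[ℝ] (Fin k → ℝ)) (D : (Fin k → ℝ) →L[ℝ] Y),
      Function.Injective (obsMap B D) ∧
      (∀ P : Polynomial ℝ, Polynomial.aeval A P = 0 → Polynomial.aeval B P = 0) ∧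
      FlowConj A C (B.prodMap (-1 : (Fin m → ℝ) →L[ℝ] (Fin m → ℝ))) (D.coprod 0) := by
  have hm' : Module.finrank ℝ (LinearMap.ker (obsMap (-A) C)) = m := by rw [ker_obsMap_neg, hm]
  have hk' : Module.finrank ℝ (LinearMap.range (obsMap (-A) C)) = k := by
    have h1 := LinearMap.finrank_range_add_finrank_ker (obsMap (-A) C)
    have h2 := LinearMap.finrank_range_add_finrank_ker (obsMap A C)
    omega
  have := FiniteDimensional.complete ℝ V
  obtain ⟨B, D, hinj, hP, hc⟩ := hA.exists_flowConj C hk' hm'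
  refine ⟨-B, D, ?_, fun P hAP => ?_, ?_⟩
  · rw [← LinearMap.ker_eq_bot, ker_obsMap_neg, LinearMap.ker_eq_bot]
    exact hinj
  -- If P annihilates A, then P(−X) annihilates −A, hence B, which says that P annihilates −B.
  · have := hP (P.comp (-Polynomial.X)) (by simpa [Polynomial.aeval_comp] using hAP)
    simpa [Polynomial.aeval_comp] using this
  · have := hc.neg
    rw [neg_neg] at this
    convert this using 1
    ext x <;> simp

end TimeReversal

/-! ### Assembling the normal form -/

namespace ObservedSystem

variable {p : ℕ}

theorem EigenvalueRe.isCoprime {m n : ℕ} {S : ObservedSystem (Fin m) p}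
    {T : ObservedSystem (Fin n) p} {P Q : ℝ → Prop} (hS : S.EigenvalueRe P) (hT : T.EigenvalueRe Q)
    (h : ∀ r, P r → ¬ Q r) : IsCoprime S.A.charpoly T.A.charpoly :=
  Polynomial.isCoprime_of_re h (fun _ hz => hS _ (mem_spectrum_map_of_aeval_charpoly hz))
    fun _ hz => hT _ (mem_spectrum_map_of_aeval_charpoly hz)

theorem expanding_field {n : ℕ} {S : ObservedSystem (Fin n) p}
    (hS : S.EigenvalueRe (fun r => 0 < r)) : Expanding S.field := expanding_matrixCLM hS

theorem expanding_neg_field {n : ℕ} {S : ObservedSystem (Fin n) p}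
    (hS : S.EigenvalueRe (fun r => r < 0)) : Expanding (-S.field) := by
  have h : Expanding (matrixCLM (-S.A)) := by
    refine expanding_matrixCLM fun μ hμ => ?_
    have e : (-S.A).map (algebraMap ℝ ℂ) = -(S.A.map (algebraMap ℝ ℂ)) := by
      ext i j
      simp
    rw [e, ← spectrum.neg_eq, Set.mem_neg] at hμ
    have := hS _ hμ
    simpa using this
  convert h using 1
  ext x
  simp [Matrix.neg_mulVec]

theorem finrank_ker_obsMap {n : ℕ} (S : ObservedSystem (Fin n) p) :
    Module.finrank ℝ (LinearMap.ker (obsMap S.field S.output)) = n - S.kObs := by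
  have := S.kObs_add_finrank_ker
  omega

theorem kObs_le {n : ℕ} (S : ObservedSystem (Fin n) p) : S.kObs ≤ n := by
  have := S.kObs_add_finrank_ker
  omega

theorem range_obsMap_blockSum_signSystem {k a b : ℕ} (R : ObservedSystem (Fin k) p) :
    LinearMap.range (obsMap (R.blockSum (signSystem a b p)).field
      (R.blockSum (signSystem a b p)).output) = LinearMap.range (obsMap R.field R.output) := by
  have h := (flowConj_blockSum R (signSystem a b p)).trans
    ((FlowConj.refl R.field R.output).prod (flowConj_signSystem a b p))
  rw [h.range_obsMap_eq, range_obsMap_coprod_zero]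

/-- The grouping of the observed and of the unobserved components. -/
def regroup (V₀ V₁ U₁ V₂ U₂ : Type*) [AddCommGroup V₀] [Module ℝ V₀] [AddCommGroup V₁] [Module ℝ V₁]
    [AddCommGroup U₁] [Module ℝ U₁] [AddCommGroup V₂] [Module ℝ V₂] [AddCommGroup U₂]
    [Module ℝ U₂] :
    (V₀ × ((V₁ × U₁) × (V₂ × U₂))) ≃ₗ[ℝ] ((V₀ × (V₁ × V₂)) × (U₁ × U₂)) where
  toFun q := ((q.1, (q.2.1.1, q.2.2.1)), (q.2.1.2, q.2.2.2))
  invFun q := (q.1.1, ((q.1.2.1, q.2.1), (q.1.2.2, q.2.2)))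
  map_add' _ _ := rfl
  map_smul' _ _ := rfl
  left_inv _ := rfl
  right_inv _ := rfl

/-- A system whose unobservable part is hyperbolic is topologically conjugate to the sum of an
observable system and a system `signSystem`. -/
theorem SpectralDecomposition.exists_topologicallyEquivalent {n : ℕ} {S : ObservedSystem (Fin n) p}
    (D : SpectralDecomposition S) (h : D.zero.kObs = D.nZero) :
    ∃ Q : ObservedSystem (Fin S.kObs) p, Q.CompletelyObservable ∧
      FlowConj S.field S.output
        (Q.blockSum (signSystem (D.nPlus - D.plus.kObs) (D.nMinus - D.minus.kObs) p)).field
        (Q.blockSum (signSystem (D.nPlus - D.plus.kObs) (D.nMinus - D.minus.kObs) p)).output ∧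
      n = S.kObs + ((D.nPlus - D.plus.kObs) + (D.nMinus - D.minus.kObs)) := by
  obtain ⟨B₁, C₁, hi₁, hP₁, hc₁⟩ := (expanding_field D.re_plus).exists_flowConj D.plus.output
    D.plus.finrank_range_obsMap D.plus.finrank_ker_obsMap
  obtain ⟨B₂, C₂, hi₂, hP₂, hc₂⟩ := (expanding_neg_field D.re_minus).exists_flowConj_neg
    D.minus.output D.minus.finrank_range_obsMap D.minus.finrank_ker_obsMap
  have hp₁ := hP₁ _ (aeval_matrixCLM_charpoly D.plus.A)
  have hp₂ := hP₂ _ (aeval_matrixCLM_charpoly D.minus.A)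
  let F := D.zero.field.prodMap (B₁.prodMap B₂)
  let G := D.zero.output.coprod (C₁.coprod C₂)
  have hinj : Function.Injective (obsMap F G) :=
    obsMap_coprod_injective (D.zero.completelyObservable_iff.1 h)
      (obsMap_coprod_injective hi₁ hi₂ hp₁ hp₂
        (D.re_plus.isCoprime D.re_minus fun r (h1 : 0 < r) (h2 : r < 0) => lt_asymm h1 h2))
      (aeval_matrixCLM_charpoly D.zero.A) (aeval_prodMap_mul_eq_zero hp₁ hp₂)
      (IsCoprime.mul_right
        (D.re_zero.isCoprime D.re_plus fun r (h1 : r = 0) (h2 : 0 < r) => h2.ne' h1)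
        (D.re_zero.isCoprime D.re_minus fun r (h1 : r = 0) (h2 : r < 0) => h2.ne h1))
  have hconj := D.linearlyEquivalent.flowConj.trans <|
    (flowConj_blockSum D.zero (D.plus.blockSum D.minus)).trans <|
    ((FlowConj.refl _ _).prod ((flowConj_blockSum D.plus D.minus).trans (hc₁.prod hc₂))).trans <|
    FlowConj.of_linearEquiv (regroup _ _ _ _ _)
      (B := F.prodMap ((1 : (Fin (D.nPlus - D.plus.kObs) → ℝ) →L[ℝ] _).prodMap
        (-1 : (Fin (D.nMinus - D.minus.kObs) → ℝ) →L[ℝ] _))) (D := G.coprod 0)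
      (fun _ => rfl) (fun q => by simp [G, regroup])
  -- The observable sum has the dimension of its jet space, which the conjugacy identifies with that
  -- of S; so the partial Kalman ranks add up to the full one.
  have hdim : Module.finrank ℝ ((Fin D.nZero → ℝ) × ((Fin D.plus.kObs → ℝ) ×
      (Fin D.minus.kObs → ℝ))) = S.kObs := by
    rw [← LinearMap.finrank_range_of_inj hinj, ← S.finrank_range_obsMap, hconj.range_obsMap_eq,
      range_obsMap_coprod_zero]
  let e : ((Fin D.nZero → ℝ) × ((Fin D.plus.kObs → ℝ) × (Fin D.minus.kObs → ℝ))) ≃ₗ[ℝ]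
    (Fin S.kObs → ℝ) := LinearEquiv.ofFinrankEq _ _ (by simpa using hdim)
  obtain ⟨QA, hQA⟩ := exists_matrixCLM_eq
    (((e.toContinuousLinearEquiv : _ →L[ℝ] (Fin S.kObs → ℝ)) ∘L F) ∘L
      (e.symm.toContinuousLinearEquiv : (Fin S.kObs → ℝ) →L[ℝ] _))
  obtain ⟨QC, hQC⟩ := exists_matrixCLM_eq
    (G ∘L (e.symm.toContinuousLinearEquiv : (Fin S.kObs → ℝ) →L[ℝ] _))
  let Q : ObservedSystem (Fin S.kObs) p := ⟨QA, QC⟩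
  have heA : ∀ x, e (F x) = Q.field (e x) := by
    intro x
    change e (F x) = matrixCLM QA (e x)
    rw [hQA]
    change _ = e (F (e.symm (e x)))
    rw [e.symm_apply_apply]
  have heC : ∀ x, Q.output (e x) = G x := by
    intro x
    change matrixCLM QC (e x) = G x
    rw [hQC]
    change G (e.symm (e x)) = _
    rw [e.symm_apply_apply]
  refine ⟨Q, Q.completelyObservable_iff.2 ?_, ?_, ?_⟩
  · intro x y hxy
    obtain ⟨x, rfl⟩ := e.surjective x
    obtain ⟨y, rfl⟩ := e.surjective y
    have he := obsMap_intertwine (A := F) (B := Q.field) (C := G) (D := Q.output)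
      (e.toContinuousLinearEquiv : _ →L[ℝ] (Fin S.kObs → ℝ)) heA heC
    exact congrArg e (hinj (((he x).symm.trans hxy).trans (he y)))
  · exact hconj.trans (((FlowConj.of_linearEquiv e heA heC).prod
      (flowConj_signSystem _ _ p).symm).trans (flowConj_blockSum Q _).symm)
  · obtain ⟨M, -⟩ := D.linearlyEquivalent
    have h1 := M.finrank_eq
    simp only [Module.finrank_fintype_fun_eq_card, Fintype.card_fin, Fintype.card_sum] at h1
    simp only [Module.finrank_prod, Module.finrank_fin_fun] at hdim
    have := D.plus.kObs_le
    have := D.minus.kObs_le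
    omega

end ObservedSystem

theorem corollary1p2 {n p : ℕ} (A : Matrix (Fin n) (Fin n) ℝ) (C : Matrix (Fin p) (Fin n) ℝ)
    (F : ∀ k : ℕ, Set (ObservedSystem (Fin k) p))
    (hF : ObservedSystem.IsLinearCanonicalForm F) :
    Nonempty (ObservedSystem.SpectralDecomposition ⟨A, C⟩) ∧
    ∀ D : ObservedSystem.SpectralDecomposition ⟨A, C⟩, D.zero.kObs = D.nZero →
      ∃! R : ObservedSystem (Fin (ObservedSystem.kObs ⟨A, C⟩)) p,
        R ∈ F (ObservedSystem.kObs ⟨A, C⟩) ∧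
        ObservedSystem.TopologicallyEquivalent ⟨A, C⟩
          (R.blockSum
            (ObservedSystem.signSystem (D.nPlus - D.plus.kObs) (D.nMinus - D.minus.kObs) p)) := by
  refine ⟨ObservedSystem.nonempty_spectralDecomposition _, fun D h => ?_⟩
  obtain ⟨Q, hQ, hconj, hdim⟩ := D.exists_topologicallyEquivalent h
  obtain ⟨R, ⟨hR, hQR⟩, -⟩ := hF.existsUnique _ Q hQ
  have hinj : ∀ T ∈ F (ObservedSystem.kObs ⟨A, C⟩),
      Function.Injective (obsMap T.field T.output) := fun T hT =>
    T.completelyObservable_iff.1 (hF.completelyObservable _ T hT)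
  have hcard : Fintype.card (Fin n) = Fintype.card (Fin (ObservedSystem.kObs ⟨A, C⟩) ⊕
      (Fin (D.nPlus - D.plus.kObs) ⊕ Fin (D.nMinus - D.minus.kObs))) := by
    simpa using hdim
  have hRtop : ObservedSystem.TopologicallyEquivalent ⟨A, C⟩ (R.blockSum
      (ObservedSystem.signSystem (D.nPlus - D.plus.kObs) (D.nMinus - D.minus.kObs) p)) :=
    ObservedSystem.topologicallyEquivalent_iff.2 ⟨hcard, hconj.trans <|
      (ObservedSystem.flowConj_blockSum Q _).trans <|
      (hQR.flowConj.prod (FlowConj.refl _ _)).trans (ObservedSystem.flowConj_blockSum R _).symm⟩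
  refine ⟨R, ⟨hR, hRtop⟩, fun T ⟨hT, hTtop⟩ => ?_⟩
  -- T and R with their unobserved summands are conjugate, so T and R have the same output jets and
  -- are linearly equivalent; both then represent the class of T.
  have hrange := ((ObservedSystem.topologicallyEquivalent_iff.1 hTtop).2.symm.trans
    (ObservedSystem.topologicallyEquivalent_iff.1 hRtop).2).range_obsMap_eq
  rw [ObservedSystem.range_obsMap_blockSum_signSystem,
    ObservedSystem.range_obsMap_blockSum_signSystem] at hrange
  exact (hF.existsUnique _ T (hF.completelyObservable _ T hT)).unique
    ⟨hT, ObservedSystem.linearlyEquivalent_of_range_eq (hinj T hT) (hinj T hT) rfl⟩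
    ⟨hR, ObservedSystem.linearlyEquivalent_of_range_eq (hinj T hT) (hinj R hR) hrange⟩
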